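/- Conventions. A skew shape $A=\lambda/\mu$ (with $\mu\subseteq\lambda$ partitions, identified with their Young diagrams in English notation) is the set of boxes of $\lambda$ that are not in $\mu$; its size $|A|$ is its number of boxes. For a composition $\alpha=(\alpha_1,\dots,\alpha_k)$ of $n$ let $S(\alpha)=\{\alpha_1,\alpha_1+\alpha_2,\dots,\alpha_1+\cdots+\alpha_{k-1}\}\subseteq\{1,\dots,n-1\}$, let $M_\alpha=\sum_{i_1<\cdots<i_k}x_{i_1}^{\alpha_1}\cdots x_{i_k}^{\alpha_k}$ be the monomial quasisymmetric function, and let $F_\alpha=\sum_{\beta:\,S(\alpha)\subseteq S(\beta)}M_\beta$ (over compositions $\beta$ of $n$) be the fundamental quasisymmetric function. The descent set of a standard Young tableau $T$ of shape $A$ is the set of $i$ such that $i+1$ appears in a lower row than $i$, and $\mathrm{comp}(T)$ is the composition of $|A|$ with $S(\mathrm{comp}(T))$ equal to this descent set. The skew Schur function of $A$ is $s_A=\sum_T F_{\mathrm{comp}(T)}$, summed over all standard Young tableaux $T$ of shape $A$. The $F$-support $\mathrm{supp}_F(A)$ is the set of compositions $\alpha$ such that $F_\alpha$ has positive coefficient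 in the expansion of $s_A$ in the basis $\{F_\alpha\}$, and $A$ is $F$-multiplicity-free if all coefficients of this expansion are $0$ or $1$. If $A$ has $r$ rows and $k\ge 1$, let $\mathrm{rows}_k(A)$ be the partition obtained by sorting into weakly decreasing order (and omitting zeros) the numbers $\mathrm{overlap}_k(1),\dots,\mathrm{overlap}_k(r-k+1)$, where $\mathrm{overlap}_k(i)$ is the number of columns occupied in common by rows $i,i+1,\dots,i+k-1$ of $A$; it is empty if $k>r$. For partitions $\lambda=(\lambda_1,\dots,\lambda_p)$ and $\nu=(\nu_1,\dots,\nu_q)$, possibly of different sizes, write $\lambda\preccurlyeq\nu$ if $\lambda_1+\cdots+\lambda_m\le\nu_1+\cdots+\nu_m$ for all $m=1,\dots,p$, where $\nu_i=0$ for $i>q$. Corollary 6.4. Let $A$ and $B$ be $F$-multiplicity-free skew shapes of the same size. Then $$\mathrm{supp}_F(A)\supseteq\mathrm{supp}_F(B)\iff \mathrm{rows}_k(A)\preccurlyeq\mathrm{rows}_k(B)\ \text{ for all } k\ge 1 .$$ -/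

import Mathlib

/-! ### Fundamental quasisymmetric functions -/

namespace QSym

/-- The bijection `α ↦ S(α)` from compositions of `n` to subsets of `{1, …, n - 1}`.
The element `i : Fin (n - 1)` stands for the number `i + 1`. -/
def subsetEquiv (n : ℕ) : Composition n ≃ Finset (Fin (n - 1)) :=
  (compositionEquiv n).trans (compositionAsSetEquiv n)

/-- `S(α)` consists of the proper nonempty partial sums of `α`. -/
theorem mem_subsetEquiv {n : ℕ} (α : Composition n) (i : Fin (n - 1)) :
    i ∈ subsetEquiv n α ↔ ∃ j, 0 < j ∧ j < α.length ∧ α.sizeUpTo j = (i : ℕ) + 1 := by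
  have h : i ∈ subsetEquiv n α ↔ (⟨1 + (i : ℕ), by omega⟩ : Fin (n + 1)) ∈ α.boundaries := by
    simp [subsetEquiv, compositionEquiv, compositionAsSetEquiv, Composition.toCompositionAsSet]
  rw [h]
  simp only [Composition.boundaries, Finset.mem_map, Finset.mem_univ, true_and]
  constructor
  · rintro ⟨j, hj⟩
    have hj' : α.sizeUpTo j = 1 + (i : ℕ) := congrArg Fin.val hj
    refine ⟨j, ?_, ?_, by omega⟩
    · rcases Nat.eq_zero_or_pos (j : ℕ) with h0 | h0
      · rw [h0, Composition.sizeUpTo_zero] at hj'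
        omega
      · exact h0
    · by_contra hlt
      have := α.sizeUpTo_ofLength_le j (by omega)
      omega
  · rintro ⟨j, _, hj, hs⟩
    refine ⟨⟨j, by omega⟩, Fin.ext ?_⟩
    change α.sizeUpTo j = 1 + (i : ℕ)
    omega

open Classical in
/-- The monomial quasisymmetric function
`M_α = ∑_{i_1 < ⋯ < i_k} x_{i_1} ^ α_1 ⋯ x_{i_k} ^ α_k`, as a formal power series:
distinct index sequences give distinct monomials, so every coefficient is `0` or `1`. -/
noncomputable def monomial {n : ℕ} (α : Composition n) : MvPowerSeries ℕ ℚ :=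
  fun e => if ∃ i : Fin α.length → ℕ, StrictMono i ∧
    e = ∑ j, Finsupp.single (i j) (α.blocksFun j) then 1 else 0

open Classical in
/-- The fundamental quasisymmetric function `F_α = ∑_{S(α) ⊆ S(β)} M_β`. -/
noncomputable def fundamental {n : ℕ} (α : Composition n) : MvPowerSeries ℕ ℚ :=
  ∑ β : Composition n with subsetEquiv n α ⊆ subsetEquiv n β, monomial β

/-- `c` is a family of coefficients expressing `f` in terms of the `F_α`, where `α` runs over the
compositions of all sizes. -/
def IsFExpansion (f : MvPowerSeries ℕ ℚ) (c : (Σ n, Composition n) →₀ ℚ) : Prop :=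
  f = c.sum fun α a => a • fundamental α.2

/-- The compositions `α` such that `F_α` has positive coefficient in the `F`-expansion of `f`. -/
def fSupport (f : MvPowerSeries ℕ ℚ) : Set (Σ n, Composition n) :=
  {α | ∃ c, IsFExpansion f c ∧ 0 < c α}

/-- All coefficients in the `F`-expansion of `f` are `0` or `1`. -/
def FMultiplicityFree (f : MvPowerSeries ℕ ℚ) : Prop :=
  ∃ c, IsFExpansion f c ∧ ∀ α, c α = 0 ∨ c α = 1

end QSym

/-! ### Skew shapes -/

/-- A skew shape `λ/μ`. Cells are pairs (row, column), with rows numbered from top to bottom. -/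
structure SkewShape where
  outer : YoungDiagram
  inner : YoungDiagram
  inner_le : inner ≤ outer

namespace SkewShape

/-- The boxes of `λ/μ`. -/
def cells (A : SkewShape) : Finset (ℕ × ℕ) := A.outer.cells \ A.inner.cells

/-- The number of boxes. -/
def size (A : SkewShape) : ℕ := A.cells.card

/-- Standard Young tableaux of shape `A`: bijective fillings of the boxes, increasing from left to
right along rows and from top to bottom down columns. The entry `t : Fin A.size` stands for the
number `t + 1`. -/
def SYT (A : SkewShape) : Type :=
  {T : {c // c ∈ A.cells} ≃ Fin A.size //
    (∀ c d, c.1.1 = d.1.1 → c.1.2 < d.1.2 → T c < T d) ∧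
    (∀ c d, c.1.2 = d.1.2 → c.1.1 < d.1.1 → T c < T d)}

noncomputable instance (A : SkewShape) : Fintype A.SYT := by
  classical
  unfold SYT
  infer_instance

/-- The row containing a given entry of a tableau. -/
def SYT.rowOf {A : SkewShape} (T : A.SYT) (t : Fin A.size) : ℕ := (T.1.symm t).1.1

/-- The descent set of `T`: those numbers `i` for which `i + 1` appears in a lower row than `i`.
As above, `i : Fin (A.size - 1)` stands for the number `i + 1`. -/
def SYT.descentSet {A : SkewShape} (T : A.SYT) : Finset (Fin (A.size - 1)) :=
  {i | T.rowOf ⟨i, by omega⟩ < T.rowOf ⟨i + 1, by omega⟩}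

/-- The descent composition of `T`. -/
def SYT.descentComposition {A : SkewShape} (T : A.SYT) : Composition A.size :=
  (QSym.subsetEquiv A.size).symm T.descentSet

/-- The skew Schur function `s_A = ∑_T F_{comp(T)}`, over the standard Young tableaux `T` of
shape `A`. -/
noncomputable def schur (A : SkewShape) : MvPowerSeries ℕ ℚ :=
  ∑ T : A.SYT, QSym.fundamental T.descentComposition

/-- The `F`-support of `A`. -/
def fSupport (A : SkewShape) : Set (Σ n, Composition n) := QSym.fSupport A.schur

/-- `A` is `F`-multiplicity-free. -/
def FMultiplicityFree (A : SkewShape) : Prop := QSym.FMultiplicityFree A.schur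

/-- The number of columns occupied in common by the `k` consecutive rows `i, …, i + k - 1`
(for `k ≥ 1`; rows are numbered from `0`). -/
def overlap (A : SkewShape) (k i : ℕ) : ℕ :=
  ((Finset.range (A.outer.rowLen 0)).filter fun j => ∀ t < k, (i + t, j) ∈ A.cells).card

/-- The partition `rows_k(A)`: the overlaps of the `k`-tuples of consecutive rows, sorted into
weakly decreasing order, with the zeros removed. Here `A.outer.colLen 0` is the number of
rows. -/
def rowsOverlap (A : SkewShape) (k : ℕ) : List ℕ :=
  (((List.range (A.outer.colLen 0 + 1 - k)).map (A.overlap k)).filter (0 < ·)).insertionSort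
    (· ≥ ·)

end SkewShape

/-- Dominance order on partitions (weakly decreasing lists of positive integers), possibly of
different sizes: `λ_1 + ⋯ + λ_m ≤ μ_1 + ⋯ + μ_m` for all `m` up to the length of `λ`, where `μ`
is padded by zeros. -/
def DominanceLE (l m : List ℕ) : Prop :=
  ∀ k ≤ l.length, (l.take k).sum ≤ (m.take k).sum

/-! ### Linear extensions of finite sets of cells and their descent words -/

namespace CellSet

/-! Reading a standard tableau as the list of its cells in the order of their entries turns tableaux
into linear extensions of the set of cells, and descent compositions into binary descent words. The
fundamental quasisymmetric functions are linearly independent, so each coefficient of the skew Schur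
function counts the linear extensions with a given word. Hence the support becomes `words`, and
multiplicity-freeness means that a linear extension is determined by its word (`MultFree`). On the
other side, the partial sums of a partition λ and the truncated sums ∑ max(λ_i - t, 0) determine
each other by conjugation. For λ the partition of k-row overlaps, the truncated sum counts the k ×
(t+1) rectangles inside the shape. So the dominance conditions for all k say exactly that A has at
most as many rectangles of each format as B.

Containment of words implies the inequalities for all skew shapes of equal size
(`rects_le_of_words_subset`). By `hasExtremal`, B has a linear extension whose word bounds the
number of rectangles in every shape having that word. It is built by filling the column tops from
left to right and recursing on the rest. A descent-free initial segment meets each column at most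
once, so removing it from any shape costs every rectangle at most its top row; for column tops the
resulting bound is sharp.

The converse needs multiplicity-freeness. This passes to windows of consecutive rows and columns,
and it excludes three minimal or three maximal cells. After deletion of empty rows and columns, a
shape is therefore a rectangle with at most two opposite corner blocks removed, and finitely many
small bad shapes together with one infinite bad family leave a short list
(`MultFree.classification`). Rotation reverses words. The word sets of hooks, of a row next to a
column, of two-row shapes (w, 2) and of their transposes are closed under reversal, so every shape
on the list has the words of a `Canonical` one, and then also its rectangle counts, by the first
direction. Among canonical shapes, the size and six rectangle counts leave only two possibilities:
equal words, or A a row next to a column and B a hook, a shape (w, 2) or its transpose. In the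
latter case the words of A are described by their number of descents alone, and containment is
immediate. -/

/-- The descent word of a sequence of cells: for each pair of consecutive cells, whether the second
one lies in a strictly lower row. -/
def descents : List (ℕ × ℕ) → List Bool
  | x :: y :: l => decide (x.1 < y.1) :: descents (y :: l)
  | _ => []

@[simp] theorem descents_nil : descents [] = [] := rfl
@[simp] theorem descents_singleton (x : ℕ × ℕ) : descents [x] = [] := rfl
@[simp] theorem descents_cons_cons (x y : ℕ × ℕ) (l : List (ℕ × ℕ)) :
    descents (x :: y :: l) = decide (x.1 < y.1) :: descents (y :: l) := rfl

theorem length_descents : ∀ l : List (ℕ × ℕ), (descents l).length = l.length - 1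
  | [] => rfl
  | [_] => rfl
  | x :: y :: l => by simp [length_descents (y :: l)]

theorem descents_append (p : List (ℕ × ℕ)) (x y : ℕ × ℕ) (q : List (ℕ × ℕ)) :
    descents (p ++ x :: y :: q) =
      descents (p ++ [x]) ++ decide (x.1 < y.1) :: descents (y :: q) := by
  induction p with
  | nil => simp
  | cons a p ih =>
    cases p with
    | nil => simp
    | cons b p => simpa using ih

theorem descents_append_of_forall {p q : List (ℕ × ℕ)} {β : Bool}
    (h : ∀ x ∈ p, ∀ y ∈ q.head?, decide (x.1 < y.1) = β) :
    descents (p ++ q) =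
      descents p ++ (if p.length = 0 ∨ q.length = 0 then [] else [β]) ++ descents q := by
  rcases List.eq_nil_or_concat p with rfl | ⟨p, x, rfl⟩
  · simp
  cases q with
  | nil => simp
  | cons y q =>
    have := h x (by simp) y (by simp)
    simp only [List.concat_eq_append, List.append_assoc, List.cons_append, List.nil_append]
    rw [descents_append, this]
    simp

theorem descents_map {φ : ℕ × ℕ → ℕ × ℕ} : ∀ {l : List (ℕ × ℕ)},
    (∀ x ∈ l, ∀ y ∈ l, (φ x).1 < (φ y).1 ↔ x.1 < y.1) → descents (l.map φ) = descents l
  | [], _ => rfl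
  | [_], _ => rfl
  | x :: y :: l, h => by
    have ih : descents ((y :: l).map φ) = descents (y :: l) :=
      descents_map fun a ha b hb => h a (List.mem_cons_of_mem _ ha) b (List.mem_cons_of_mem _ hb)
    simp only [List.map_cons, descents_cons_cons] at ih ⊢
    rw [ih, decide_eq_decide.2 (h x (by simp) y (by simp))]

theorem descents_reverse_map {φ : ℕ × ℕ → ℕ × ℕ} : ∀ {l : List (ℕ × ℕ)},
    (∀ x ∈ l, ∀ y ∈ l, (φ x).1 < (φ y).1 ↔ y.1 < x.1) →
      descents (l.map φ).reverse = (descents l).reverse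
  | [], _ => rfl
  | [_], _ => rfl
  | x :: y :: l, h => by
    have ih : descents ((y :: l).map φ).reverse = (descents (y :: l)).reverse :=
      descents_reverse_map fun a ha b hb =>
        h a (List.mem_cons_of_mem _ ha) b (List.mem_cons_of_mem _ hb)
    simp only [List.map_cons, List.reverse_cons, List.append_assoc, List.cons_append,
      List.nil_append, descents_cons_cons] at ih ⊢
    have := h y (by simp) x (by simp)
    rw [descents_append, ih, show decide ((φ y).1 < (φ x).1) = decide (x.1 < y.1) from
      decide_eq_decide.2 this]
    simp

theorem descents_eq_of_forall_tail {f : ℕ × ℕ → Bool} : ∀ {l : List (ℕ × ℕ)},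
    l.Pairwise (fun x y => decide (x.1 < y.1) = f y) → descents l = l.tail.map f
  | [], _ => rfl
  | [_], _ => rfl
  | x :: y :: l, h => by
    have ih := descents_eq_of_forall_tail (List.pairwise_cons.1 h).2
    have := (List.pairwise_cons.1 h).1 y (by simp)
    simp only [descents_cons_cons, List.tail_cons, List.map_cons] at ih ⊢
    rw [ih, this]

theorem isChain_of_descents_eq_replicate {R : ℕ × ℕ → ℕ × ℕ → Prop} {β : Bool}
    {S : ℕ × ℕ → ℕ × ℕ → Prop} (hR : ∀ x y, S x y → decide (x.1 < y.1) = β → R x y) :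
    ∀ {l : List (ℕ × ℕ)}, l.IsChain S → descents l = List.replicate (l.length - 1) β →
      l.IsChain R
  | [], _, _ => .nil
  | [_], _, _ => .singleton _
  | x :: y :: l, hS, h => by
    rw [List.isChain_cons_cons] at hS ⊢
    simp only [descents_cons_cons, List.length_cons, Nat.add_sub_cancel,
      List.replicate_succ, List.cons.injEq] at h
    exact ⟨hR x y hS.1 h.1, isChain_of_descents_eq_replicate hR hS.2 (by simpa using h.2)⟩

theorem descents_eq_replicate {β : Bool} : ∀ {l : List (ℕ × ℕ)},
    l.Pairwise (fun x y => decide (x.1 < y.1) = β) → descents l = List.replicate (l.length - 1) β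
  | [], _ => rfl
  | [_], _ => rfl
  | x :: y :: l, h => by
    have ih := descents_eq_replicate (List.pairwise_cons.1 h).2
    have := (List.pairwise_cons.1 h).1 y (by simp)
    simp only [descents_cons_cons, ih, this, List.length_cons, Nat.add_sub_cancel,
      List.replicate_succ]

/-- `l` lists the cells of `C`, each once, in an order refining the product order. -/
structure IsLinExt (C : Finset (ℕ × ℕ)) (l : List (ℕ × ℕ)) : Prop where
  mem_iff : ∀ x, x ∈ l ↔ x ∈ C
  pairwise : l.Pairwise fun a b => ¬ b ≤ a

/-- The descent words of the linear extensions of `C`. -/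
def words (C : Finset (ℕ × ℕ)) : Set (List Bool) := {w | ∃ l, IsLinExt C l ∧ descents l = w}

/-- Distinct linear extensions of `C` have distinct descent words. -/
def MultFree (C : Finset (ℕ × ℕ)) : Prop :=
  ∀ l₁ l₂, IsLinExt C l₁ → IsLinExt C l₂ → descents l₁ = descents l₂ → l₁ = l₂

variable {C C' X Y : Finset (ℕ × ℕ)} {l p q : List (ℕ × ℕ)}

theorem IsLinExt.nodup (h : IsLinExt C l) : l.Nodup :=
  h.pairwise.imp fun hab e => hab e.ge

theorem IsLinExt.toFinset_eq (h : IsLinExt C l) : l.toFinset = C := by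
  ext x; simp [h.mem_iff]

theorem IsLinExt.length_eq (h : IsLinExt C l) : l.length = C.card := by
  rw [← h.toFinset_eq, List.toFinset_card_of_nodup h.nodup]

theorem exists_isLinExt (C : Finset (ℕ × ℕ)) : ∃ l, IsLinExt C l := by
  induction C using Finset.strongInduction with
  | H C ih =>
    rcases C.eq_empty_or_nonempty with rfl | hC
    · exact ⟨[], by simp, .nil⟩
    obtain ⟨m, hm⟩ := C.exists_maximal hC
    obtain ⟨l, hl⟩ := ih (C.erase m) (Finset.erase_ssubset hm.prop)
    refine ⟨l ++ [m], fun x => ?_, ?_⟩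
    · by_cases hx : x = m <;> simp [hl.mem_iff, hx, hm.prop]
    · rw [List.pairwise_append]
      refine ⟨hl.pairwise, by simp, fun a ha b hb hba => ?_⟩
      rw [List.mem_singleton] at hb
      subst hb
      have ha' := (hl.mem_iff a).1 ha
      rw [Finset.mem_erase] at ha'
      exact ha'.1 (le_antisymm (hm.le_of_ge ha'.2 hba) hba)

theorem IsLinExt.append (hp : IsLinExt X p) (hq : IsLinExt Y q)
    (hC : ∀ x, x ∈ C ↔ x ∈ X ∨ x ∈ Y) (hXY : ∀ x ∈ X, ∀ y ∈ Y, ¬ y ≤ x) :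
    IsLinExt C (p ++ q) := by
  refine ⟨fun x => by simp [hp.mem_iff, hq.mem_iff, hC], ?_⟩
  rw [List.pairwise_append]
  exact ⟨hp.pairwise, hq.pairwise, fun a ha b hb =>
    hXY a ((hp.mem_iff a).1 ha) b ((hq.mem_iff b).1 hb)⟩

theorem IsLinExt.of_append (h : IsLinExt C (p ++ q)) :
    IsLinExt p.toFinset p ∧ IsLinExt q.toFinset q ∧ (∀ x, x ∈ C ↔ x ∈ p ∨ x ∈ q) ∧
      ∀ x ∈ p, ∀ y ∈ q, ¬ y ≤ x := by
  obtain ⟨h1, h2, h3⟩ := List.pairwise_append.1 h.pairwise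
  exact ⟨⟨by simp, h1⟩, ⟨by simp, h2⟩, fun x => by rw [← h.mem_iff, List.mem_append], h3⟩

theorem IsLinExt.head_minimal {y : ℕ × ℕ} (h : IsLinExt C (y :: l)) :
    y ∈ C ∧ ∀ z ∈ C, z ≤ y → z = y := by
  refine ⟨(h.mem_iff y).1 (by simp), fun z hz hzy => ?_⟩
  rw [← h.mem_iff, List.mem_cons] at hz
  rcases hz with hz | hz
  · exact hz
  · exact absurd hzy ((List.pairwise_cons.1 h.pairwise).1 z hz)

/-- If in every concatenation of linear extensions of `X` and `Y` the boundary between them has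
the same descent status, then multiplicity-freeness passes to `X` and `Y`. -/
theorem MultFree.of_split (h : MultFree C) (β : Bool)
    (hC : ∀ x, x ∈ C ↔ x ∈ X ∨ x ∈ Y) (hXY : ∀ x ∈ X, ∀ y ∈ Y, ¬ y ≤ x)
    (hβ : ∀ x ∈ X, ∀ y ∈ Y, (∀ z ∈ Y, z ≤ y → z = y) → decide (x.1 < y.1) = β) :
    MultFree X ∧ MultFree Y := by
  have key : ∀ p q, IsLinExt X p → IsLinExt Y q → descents (p ++ q) =
      descents p ++ (if X.card = 0 ∨ Y.card = 0 then [] else [β]) ++ descents q := by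
    intro p q hp hq
    rw [descents_append_of_forall (β := β), hp.length_eq, hq.length_eq]
    intro x hx y hy
    cases q with
    | nil => simp at hy
    | cons y' q =>
      simp only [List.head?_cons, Option.mem_def, Option.some.injEq] at hy
      subst hy
      exact hβ x ((hp.mem_iff x).1 hx) _ hq.head_minimal.1 hq.head_minimal.2
  constructor
  · intro l₁ l₂ h₁ h₂ e
    obtain ⟨q, hq⟩ := exists_isLinExt Y
    have := h _ _ (h₁.append hq hC hXY) (h₂.append hq hC hXY)
      (by rw [key _ _ h₁ hq, key _ _ h₂ hq, e])
    exact List.append_cancel_right this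
  · intro l₁ l₂ h₁ h₂ e
    obtain ⟨p, hp⟩ := exists_isLinExt X
    have := h _ _ (hp.append h₁ hC hXY) (hp.append h₂ hC hXY)
      (by rw [key _ _ hp h₁, key _ _ hp h₂, e])
    exact List.append_cancel_left this

/-- Being a skew shape: together with two cells, the whole rectangle between them. -/
def Convex (C : Finset (ℕ × ℕ)) : Prop :=
  ∀ x ∈ C, ∀ y ∈ C, ∀ z, x ≤ z → z ≤ y → z ∈ C

/-- When the upper rows are filled first, the step into the lower rows is always a descent. -/
theorem MultFree.filter_row (h : MultFree C) (r : ℕ) :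
    MultFree (C.filter fun x => x.1 < r) ∧ MultFree (C.filter fun x => r ≤ x.1) := by
  refine h.of_split true (fun x => ?_) ?_ ?_
  · simp only [Finset.mem_filter]
    have := lt_or_ge x.1 r
    tauto
  · intro x hx y hy hyx
    simp only [Finset.mem_filter] at hx hy
    have := hyx.1
    omega
  · intro x hx y hy _
    simp only [Finset.mem_filter] at hx hy
    simp; omega

/-- When the left columns are filled first, the step from `x` to the first cell `y` of the right
part is never a descent: otherwise convexity would put the cell in the row of `x` and the column of
`y` into the right part, strictly above `y`. -/
theorem MultFree.filter_col (h : MultFree C) (hC : Convex C) (c : ℕ) :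
    MultFree (C.filter fun x => x.2 < c) ∧ MultFree (C.filter fun x => c ≤ x.2) := by
  refine h.of_split false (fun x => ?_) ?_ ?_
  · simp only [Finset.mem_filter]
    have := lt_or_ge x.2 c
    tauto
  · intro x hx y hy hyx
    simp only [Finset.mem_filter] at hx hy
    have := hyx.2
    omega
  · intro x hx y hy hmin
    simp only [Finset.mem_filter] at hx hy
    rw [decide_eq_false_iff_not]
    intro hlt
    have hz : (x.1, y.2) ∈ C := hC x hx.1 y hy.1 _ ⟨le_rfl, by simp; omega⟩ ⟨hlt.le, le_rfl⟩
    have := congrArg Prod.fst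
      (hmin (x.1, y.2) (by simp [hz, hy.2]) ⟨hlt.le, le_rfl⟩)
    simp at this
    omega

theorem Convex.filter (h : Convex C) {P : ℕ × ℕ → Prop} [DecidablePred P]
    (hP : ∀ x y z, P x → P y → x ≤ z → z ≤ y → P z) : Convex (C.filter P) := by
  intro x hx y hy z hxz hzy
  simp only [Finset.mem_filter] at hx hy ⊢
  exact ⟨h x hx.1 y hy.1 z hxz hzy, hP x y z hx.2 hy.2 hxz hzy⟩

/-- A bijection between sets of cells preserving order and the relative position of rows. -/
structure IsIso (C C' : Finset (ℕ × ℕ)) (φ : ℕ × ℕ → ℕ × ℕ) : Prop where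
  mem : ∀ x ∈ C, φ x ∈ C'
  surj : ∀ y ∈ C', ∃ x ∈ C, φ x = y
  le_iff : ∀ x ∈ C, ∀ y ∈ C, φ x ≤ φ y ↔ x ≤ y
  lt_iff : ∀ x ∈ C, ∀ y ∈ C, (φ x).1 < (φ y).1 ↔ x.1 < y.1

theorem exists_map_eq {φ : ℕ × ℕ → ℕ × ℕ} (mem : ∀ x ∈ C, φ x ∈ C')
    (surj : ∀ y ∈ C', ∃ x ∈ C, φ x = y) (inj : ∀ x ∈ C, ∀ y ∈ C, φ x = φ y → x = y)
    (hl : ∀ y, y ∈ l ↔ y ∈ C') : ∃ l' : List (ℕ × ℕ), (∀ x, x ∈ l' ↔ x ∈ C) ∧ l'.map φ = l := by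
  have hinv : ∀ y ∈ l, φ (Function.invFunOn φ C y) = y := fun y hy =>
    Function.invFunOn_eq (surj y ((hl y).1 hy))
  have hinvm : ∀ y ∈ l, Function.invFunOn φ C y ∈ C := fun y hy =>
    Function.invFunOn_mem (s := (C : Set (ℕ × ℕ))) (surj y ((hl y).1 hy))
  refine ⟨l.map (Function.invFunOn φ C), fun x => ?_, ?_⟩
  · rw [List.mem_map]
    constructor
    · rintro ⟨y, hy, rfl⟩
      exact hinvm y hy
    · intro hx
      have := (hl _).2 (mem x hx)
      exact ⟨φ x, this, inj _ (hinvm _ this) _ hx (hinv _ this)⟩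
  · rw [List.map_map]
    conv_rhs => rw [← List.map_id l]
    exact List.map_congr_left hinv

namespace IsIso

variable {φ : ℕ × ℕ → ℕ × ℕ}

theorem inj (h : IsIso C C' φ) : ∀ x ∈ C, ∀ y ∈ C, φ x = φ y → x = y := fun x hx y hy e =>
  le_antisymm ((h.le_iff x hx y hy).1 e.le) ((h.le_iff y hy x hx).1 e.ge)

theorem map (h : IsIso C C' φ) (hl : IsLinExt C l) :
    IsLinExt C' (l.map φ) ∧ descents (l.map φ) = descents l := by
  refine ⟨⟨fun y => ?_, ?_⟩, descents_map fun x hx y hy =>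
    h.lt_iff x ((hl.mem_iff x).1 hx) y ((hl.mem_iff y).1 hy)⟩
  · rw [List.mem_map]
    constructor
    · rintro ⟨x, hx, rfl⟩
      exact h.mem x ((hl.mem_iff x).1 hx)
    · intro hy
      obtain ⟨x, hx, rfl⟩ := h.surj y hy
      exact ⟨x, (hl.mem_iff x).2 hx, rfl⟩
  · rw [List.pairwise_map]
    refine hl.pairwise.imp_of_mem fun {a b} ha hb hab => ?_
    rwa [h.le_iff b ((hl.mem_iff b).1 hb) a ((hl.mem_iff a).1 ha)]

theorem lift (h : IsIso C C' φ) (hl : IsLinExt C' l) :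
    ∃ l', IsLinExt C l' ∧ l'.map φ = l := by
  obtain ⟨l', h1, rfl⟩ := exists_map_eq h.mem h.surj h.inj hl.mem_iff
  refine ⟨l', ⟨h1, ?_⟩, rfl⟩
  refine (List.pairwise_map.1 hl.pairwise).imp_of_mem fun {a b} ha hb hab => ?_
  rwa [h.le_iff b ((h1 b).1 hb) a ((h1 a).1 ha)] at hab

theorem words_eq (h : IsIso C C' φ) : words C' = words C := by
  ext w
  constructor
  · rintro ⟨l, hl, rfl⟩
    obtain ⟨l', hl', rfl⟩ := h.lift hl
    exact ⟨l', hl', ((h.map hl').2).symm⟩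
  · rintro ⟨l, hl, rfl⟩
    exact ⟨_, (h.map hl).1, (h.map hl).2⟩

theorem multFree (h : IsIso C C' φ) (hC : MultFree C) : MultFree C' := by
  intro l₁ l₂ h₁ h₂ e
  obtain ⟨l₁, h₁', rfl⟩ := h.lift h₁
  obtain ⟨l₂, h₂', rfl⟩ := h.lift h₂
  rw [(h.map h₁').2, (h.map h₂').2] at e
  rw [hC _ _ h₁' h₂' e]

theorem card_eq (h : IsIso C C' φ) : C'.card = C.card :=
  (Finset.card_bij (fun x _ => φ x) h.mem (fun x hx y hy e => h.inj x hx y hy e)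
    (fun y hy => by obtain ⟨x, hx, e⟩ := h.surj y hy; exact ⟨x, hx, e⟩)).symm

end IsIso

/-- A bijection between sets of cells reversing order and the relative position of rows. -/
structure IsAntiIso (C C' : Finset (ℕ × ℕ)) (φ : ℕ × ℕ → ℕ × ℕ) : Prop where
  mem : ∀ x ∈ C, φ x ∈ C'
  surj : ∀ y ∈ C', ∃ x ∈ C, φ x = y
  le_iff : ∀ x ∈ C, ∀ y ∈ C, φ x ≤ φ y ↔ y ≤ x
  lt_iff : ∀ x ∈ C, ∀ y ∈ C, (φ x).1 < (φ y).1 ↔ y.1 < x.1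

namespace IsAntiIso

variable {φ : ℕ × ℕ → ℕ × ℕ}

theorem inj (h : IsAntiIso C C' φ) : ∀ x ∈ C, ∀ y ∈ C, φ x = φ y → x = y := fun x hx y hy e =>
  le_antisymm ((h.le_iff y hy x hx).1 e.ge) ((h.le_iff x hx y hy).1 e.le)

theorem map (h : IsAntiIso C C' φ) (hl : IsLinExt C l) :
    IsLinExt C' (l.map φ).reverse ∧ descents (l.map φ).reverse = (descents l).reverse := by
  refine ⟨⟨fun y => ?_, ?_⟩, descents_reverse_map fun x hx y hy =>
    h.lt_iff x ((hl.mem_iff x).1 hx) y ((hl.mem_iff y).1 hy)⟩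
  · rw [List.mem_reverse, List.mem_map]
    constructor
    · rintro ⟨x, hx, rfl⟩
      exact h.mem x ((hl.mem_iff x).1 hx)
    · intro hy
      obtain ⟨x, hx, rfl⟩ := h.surj y hy
      exact ⟨x, (hl.mem_iff x).2 hx, rfl⟩
  · rw [List.pairwise_reverse, List.pairwise_map]
    refine hl.pairwise.imp_of_mem fun {a b} ha hb hab => ?_
    rwa [h.le_iff a ((hl.mem_iff a).1 ha) b ((hl.mem_iff b).1 hb)]

theorem lift (h : IsAntiIso C C' φ) (hl : IsLinExt C' l) :
    ∃ l', IsLinExt C l' ∧ (l'.map φ).reverse = l := by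
  obtain ⟨l', h1, e⟩ := exists_map_eq h.mem h.surj h.inj (l := l.reverse)
    (fun y => by rw [List.mem_reverse, hl.mem_iff])
  obtain rfl : l = (l'.map φ).reverse := by rw [e, List.reverse_reverse]
  refine ⟨l', ⟨h1, ?_⟩, rfl⟩
  refine (List.pairwise_map.1 (List.pairwise_reverse.1 hl.pairwise)).imp_of_mem
    fun {a b} ha hb hab => ?_
  rwa [h.le_iff a ((h1 a).1 ha) b ((h1 b).1 hb)] at hab

theorem words_eq (h : IsAntiIso C C' φ) : words C' = List.reverse '' words C := by
  ext w
  constructor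
  · rintro ⟨l, hl, rfl⟩
    obtain ⟨l', hl', rfl⟩ := h.lift hl
    exact ⟨_, ⟨l', hl', rfl⟩, ((h.map hl').2).symm⟩
  · rintro ⟨_, ⟨l, hl, rfl⟩, rfl⟩
    exact ⟨_, (h.map hl).1, (h.map hl).2⟩

theorem multFree (h : IsAntiIso C C' φ) (hC : MultFree C) : MultFree C' := by
  intro l₁ l₂ h₁ h₂ e
  obtain ⟨l₁, h₁', rfl⟩ := h.lift h₁
  obtain ⟨l₂, h₂', rfl⟩ := h.lift h₂
  rw [(h.map h₁').2, (h.map h₂').2, List.reverse_inj] at e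
  rw [hC _ _ h₁' h₂' e]

end IsAntiIso

/-! ### Transposition complements descent words -/

/-- In a linear extension of a skew shape, the cell following `x` cannot lie strictly below and
strictly to the right of `x`. -/
theorem IsLinExt.not_lt_lt (h : IsLinExt C l) (hC : Convex C) {x y : ℕ × ℕ}
    (hl : l = p ++ x :: y :: q) (h1 : x.1 < y.1) : ¬ x.2 < y.2 := by
  intro h2
  subst hl
  have hx := (h.mem_iff x).1 (by simp)
  have hy := (h.mem_iff y).1 (by simp)
  have hz : (x.1, y.2) ∈ C := hC x hx y hy _ ⟨le_rfl, h2.le⟩ ⟨h1.le, le_rfl⟩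
  rw [← h.mem_iff] at hz
  obtain ⟨-, h3, h4⟩ := List.pairwise_append.1 h.pairwise
  simp only [List.mem_append, List.mem_cons] at hz
  rcases hz with hz | hz | hz | hz
  · exact h4 _ hz x (by simp) ⟨le_rfl, h2.le⟩
  · have := congrArg Prod.snd hz
    simp at this; omega
  · have := congrArg Prod.fst hz
    simp at this; omega
  · exact (List.pairwise_cons.1 (List.pairwise_cons.1 h3).2).1 _ hz ⟨h1.le, le_rfl⟩

/-- A step goes either strictly down and weakly left, or weakly up and strictly right, since a step
strictly down and strictly right is impossible in a convex set. Transposition exchanges the two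
kinds. -/
theorem IsLinExt.descents_map_swap (h : IsLinExt C l) (hC : Convex C) :
    descents (l.map Prod.swap) = (descents l).map not := by
  suffices ∀ q p, l = p ++ q → descents (q.map Prod.swap) = (descents q).map not from this l [] rfl
  intro q
  induction q with
  | nil => simp
  | cons x q ih =>
    cases q with
    | nil => simp
    | cons y q =>
      intro p hl
      have := ih (p ++ [x]) (by simpa using hl)
      simp only [List.map_cons, descents_cons_cons, Prod.fst_swap] at this ⊢
      rw [this]
      congr 1
      have hyx : ¬ y ≤ x := by
        have := h.pairwise
        rw [hl, List.pairwise_append, List.pairwise_cons] at this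
        exact this.2.1.1 y (by simp)
      have hnl := h.not_lt_lt hC hl
      rw [Prod.le_def] at hyx
      by_cases h1 : x.1 < y.1
      · simp [h1]; have := hnl h1; omega
      · simp [h1]; omega

theorem IsLinExt.map_swap (h : IsLinExt C l) :
    IsLinExt (C.image Prod.swap) (l.map Prod.swap) := by
  refine ⟨fun x => by simp [h.mem_iff], ?_⟩
  rw [List.pairwise_map]
  exact h.pairwise.imp fun hab => by simpa using hab

theorem image_swap_image_swap (C : Finset (ℕ × ℕ)) : (C.image Prod.swap).image Prod.swap = C := by
  simp [Finset.image_image]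

theorem Convex.image_swap (h : Convex C) : Convex (C.image Prod.swap) := by
  intro x hx y hy z hxz hzy
  simp only [Finset.mem_image, Prod.exists, Prod.swap_prod_mk] at hx hy ⊢
  obtain ⟨a, b, hx, rfl⟩ := hx
  obtain ⟨c, d, hy, rfl⟩ := hy
  exact ⟨z.2, z.1, h _ hx _ hy _ ⟨hxz.2, hxz.1⟩ ⟨hzy.2, hzy.1⟩, rfl⟩

theorem words_image_swap (hC : Convex C) :
    words (C.image Prod.swap) = List.map not '' words C := by
  ext w
  constructor
  · rintro ⟨l, hl, rfl⟩
    have h2 := hl.map_swap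
    rw [image_swap_image_swap] at h2
    refine ⟨_, ⟨_, h2, rfl⟩, ?_⟩
    rw [← h2.descents_map_swap hC, List.map_map]
    simp
  · rintro ⟨_, ⟨l, hl, rfl⟩, rfl⟩
    exact ⟨_, hl.map_swap, hl.descents_map_swap hC⟩

theorem MultFree.image_swap (h : MultFree C) (hC : Convex C) : MultFree (C.image Prod.swap) := by
  intro l₁ l₂ h₁ h₂ e
  have k₁ := h₁.map_swap
  have k₂ := h₂.map_swap
  rw [image_swap_image_swap] at k₁ k₂
  have := h _ _ k₁ k₂ (by
    rw [h₁.descents_map_swap hC.image_swap, h₂.descents_map_swap hC.image_swap, e])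
  exact List.map_injective_iff.2 Prod.swap_injective this

end CellSet

namespace CellSet

variable {C C' : Finset (ℕ × ℕ)}

/-! ### Rectangle counts -/

/-- The number of `k × l` rectangles contained in `C`. -/
def rects (k l : ℕ) (C : Finset (ℕ × ℕ)) : ℕ :=
  (C.filter fun x => ∀ a < k, ∀ b < l, (x.1 + a, x.2 + b) ∈ C).card

theorem rects_one_one (C : Finset (ℕ × ℕ)) : rects 1 1 C = C.card := by
  unfold rects
  congr 1
  refine Finset.filter_true_of_mem fun x hx a ha b hb => ?_
  obtain rfl : a = 0 := by omega
  obtain rfl : b = 0 := by omega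
  simpa using hx

theorem rects_image_swap (k l : ℕ) (C : Finset (ℕ × ℕ)) :
    rects k l (C.image Prod.swap) = rects l k C := by
  unfold rects
  refine (Finset.card_bij (fun x _ => x.swap) ?_ ?_ ?_).symm
  · intro x hx
    simp only [Finset.mem_filter, Finset.mem_image, Prod.exists, Prod.swap_prod_mk] at hx ⊢
    exact ⟨⟨_, _, hx.1, rfl⟩, fun a ha b hb => ⟨_, _, hx.2 b hb a ha, rfl⟩⟩
  · intro x _ y _ e
    exact Prod.swap_injective e
  · intro x hx
    simp only [Finset.mem_filter, Finset.mem_image, Prod.exists, Prod.swap_prod_mk] at hx ⊢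
    obtain ⟨⟨a, b, h, rfl⟩, h2⟩ := hx
    refine ⟨a, b, ⟨h, fun i hi j hj => ?_⟩, rfl⟩
    obtain ⟨c, d, h3, h4⟩ := h2 j hj i hi
    simp only [Prod.mk.injEq] at h4
    rwa [← h4.1, ← h4.2]

theorem descents_append_inj : ∀ {p p' q q' : List (ℕ × ℕ)}, p.length = p'.length →
    descents (p ++ q) = descents (p' ++ q') →
      descents p = descents p' ∧ descents q = descents q'
  | [], [], _, _, _, h => ⟨rfl, h⟩
  | [x], [x'], [], [], _, _ => ⟨rfl, rfl⟩
  | [x], [x'], [], y' :: q', _, h => by simp at h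
  | [x], [x'], y :: q, [], _, h => by simp at h
  | [x], [x'], y :: q, y' :: q', _, h => by simp at h; exact ⟨rfl, h.2⟩
  | x :: y :: p, x' :: y' :: p', q, q', hl, h => by
    simp only [List.cons_append, descents_cons_cons, List.cons.injEq] at h
    have := descents_append_inj (p := y :: p) (p' := y' :: p') (by simpa using hl) h.2
    simp [this.1, this.2, h.1]

/-! ### Column tops and extremal linear extensions -/

/-- The topmost cells of the columns. -/
def tops (C : Finset (ℕ × ℕ)) : Finset (ℕ × ℕ) :=
  C.filter fun x => ∀ y ∈ C, y.2 = x.2 → x.1 ≤ y.1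

theorem mem_sdiff_tops {x : ℕ × ℕ} :
    x ∈ C \ tops C ↔ x ∈ C ∧ ∃ i < x.1, (i, x.2) ∈ C := by
  simp only [tops, Finset.mem_sdiff, Finset.mem_filter, not_and, not_forall, not_le]
  constructor
  · rintro ⟨h, h2⟩
    obtain ⟨y, hy, e, hlt⟩ := h2 h
    exact ⟨h, y.1, hlt, by rwa [← e]⟩
  · rintro ⟨h, i, hi, h2⟩
    exact ⟨h, fun _ => ⟨_, h2, rfl, hi⟩⟩

theorem Convex.sdiff_tops (hC : Convex C) : Convex (C \ tops C) := by
  intro x hx y hy z hxz hzy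
  rw [mem_sdiff_tops] at hx hy ⊢
  obtain ⟨hx, i, hi, hx'⟩ := hx
  have hz := hC x hx y hy.1 z hxz hzy
  have := hxz.1
  exact ⟨hz, i, by omega, hC _ hx' z hz _ ⟨le_rfl, hxz.2⟩ ⟨by simp; omega, le_rfl⟩⟩

/-- This allows all column tops to be filled before the rest. If `y ≤ x`, the cell above `y` would
force, by convexity, a cell above `x` in its own column. -/
theorem Convex.not_le_tops (hC : Convex C) {x y : ℕ × ℕ} (hx : x ∈ tops C)
    (hy : y ∈ C \ tops C) : ¬ y ≤ x := by
  intro hyx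
  rw [mem_sdiff_tops] at hy
  obtain ⟨hy, i, hi, hy'⟩ := hy
  simp only [tops, Finset.mem_filter] at hx
  have h1 := hyx.1
  have := hx.2 (i, x.2) (hC _ hy' x hx.1 _ ⟨le_rfl, hyx.2⟩ ⟨by simp; omega, le_rfl⟩) rfl
  simp at this; omega

theorem exists_sorted_list {α : Type*} [DecidableEq α] (f : α → ℕ) (H : Finset α) :
    ∃ p : List α, (∀ x, x ∈ p ↔ x ∈ H) ∧ p.Nodup ∧ p.Pairwise fun x y => f x ≤ f y := by
  induction H using Finset.strongInduction with
  | H H ih =>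
    rcases H.eq_empty_or_nonempty with rfl | hH
    · exact ⟨[], by simp, by simp, .nil⟩
    obtain ⟨m, hm, hmin⟩ := H.exists_min_image f hH
    obtain ⟨p, h1, h2, h3⟩ := ih (H.erase m) (Finset.erase_ssubset hm)
    refine ⟨m :: p, fun x => ?_, ?_, ?_⟩
    · by_cases hx : x = m <;> simp [h1, hx, hm]
    · simp [h1, h2]
    · refine List.pairwise_cons.2 ⟨fun x hx => hmin x ?_, h3⟩
      exact Finset.mem_of_mem_erase ((h1 x).1 hx)

/-- From left to right, the column tops of a skew shape never move down. -/
theorem exists_isLinExt_tops (hC : Convex C) : ∃ p, IsLinExt (tops C) p ∧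
    descents p = List.replicate (p.length - 1) false := by
  obtain ⟨p, h1, h2, h3⟩ := exists_sorted_list Prod.snd (tops C)
  have h4 : p.Pairwise fun x y => x.2 < y.2 := by
    refine (List.pairwise_and_iff.2 ⟨h3, h2⟩).imp_of_mem fun {x y} hx hy h => ?_
    refine lt_of_le_of_ne h.1 fun e => h.2 (Prod.ext ?_ e)
    rw [h1] at hx hy
    simp only [tops, Finset.mem_filter] at hx hy
    exact le_antisymm (hx.2 y hy.1 e.symm) (hy.2 x hx.1 e)
  refine ⟨p, ⟨h1, h4.imp fun h hle => ?_⟩, descents_eq_replicate (h4.imp_of_mem ?_)⟩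
  · have := hle.2
    omega
  · intro x y hx hy hxy
    rw [decide_eq_false_iff_not]
    intro hlt
    rw [h1] at hx hy
    simp only [tops, Finset.mem_filter] at hx hy
    have := hy.2 (x.1, y.2) (hC x hx.1 y hy.1 _ ⟨le_rfl, hxy.le⟩ ⟨hlt.le, le_rfl⟩) rfl
    simp at this; omega

/-- Each cell that is not a column top has a cell directly above it, so a rectangle among these
cells extends upwards by one row. -/
theorem rects_sdiff_tops_le (k l : ℕ) (hC : Convex C) :
    rects (k + 1) l (C \ tops C) ≤ rects (k + 2) l C := by
  unfold rects
  refine Finset.card_le_card_of_injOn (fun x => (x.1 - 1, x.2)) ?_ ?_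
  · intro x hx
    simp only [Finset.coe_filter, Set.mem_ofPred_eq] at hx ⊢
    obtain ⟨hx, h⟩ := hx
    rw [mem_sdiff_tops] at hx
    obtain ⟨hxC, i, hi, hi'⟩ := hx
    have hx1 : (x.1 - 1, x.2) ∈ C :=
      hC _ hi' x hxC _ ⟨by simp; omega, le_rfl⟩ ⟨by simp, le_rfl⟩
    refine ⟨hx1, fun a ha b hb => ?_⟩
    rcases Nat.eq_zero_or_pos a with rfl | ha0
    · have h0 := h 0 (by omega) b hb
      rw [mem_sdiff_tops] at h0
      obtain ⟨h0, i, hi, h1⟩ := h0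
      simp only [add_zero] at hi h0 h1
      exact hC _ h1 _ h0 _ ⟨by simp; omega, le_rfl⟩ ⟨by simp, le_rfl⟩
    · have h0 := h (a - 1) (by omega) b hb
      rw [show x.1 - 1 + a = x.1 + (a - 1) by omega]
      exact (Finset.mem_sdiff.1 h0).1
  · intro x hx y hy e
    simp only [Finset.coe_filter, Set.mem_ofPred_eq, mem_sdiff_tops] at hx hy
    obtain ⟨⟨_, i, hi, _⟩, _⟩ := hx
    obtain ⟨⟨_, j, hj, _⟩, _⟩ := hy
    simp only [Prod.mk.injEq] at e
    exact Prod.ext (by omega) e.2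

/-- A descent-free initial segment contains at most one cell of each column, so of two vertically
adjacent cells the lower one lies in `q`. Hence a rectangle without its top row lies in `q`. -/
theorem rects_le_of_append {p q : List (ℕ × ℕ)} (k l : ℕ) (h : IsLinExt C (p ++ q))
    (hp : descents p = List.replicate (p.length - 1) false) :
    rects (k + 2) (l + 1) C ≤ rects (k + 1) (l + 1) q.toFinset := by
  obtain ⟨h1, -, h3, h4⟩ := h.of_append
  have hcol : p.Pairwise fun x y => x.2 < y.2 := by
    -- A non-descent that respects the product order moves strictly right; this propagates from
    -- neighbours to all pairs by transitivity.
    have : IsTrans (ℕ × ℕ) fun x y => x.2 < y.2 := ⟨fun _ _ _ h h' => lt_trans h h'⟩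
    rw [← List.isChain_iff_pairwise]
    refine isChain_of_descents_eq_replicate (fun x y hxy hd => ?_) h1.pairwise.isChain hp
    rw [decide_eq_false_iff_not] at hd
    rw [Prod.le_def] at hxy
    omega
  have hmem : ∀ i j, (i, j) ∈ C → (i + 1, j) ∈ C → (i + 1, j) ∈ q := by
    intro i j hi hi1
    rcases (h3 _).1 hi1 with hp1 | hq1
    · rcases (h3 _).1 hi with hp0 | hq0
      · have hnd : (p.map Prod.snd).Nodup := List.pairwise_map.2 (hcol.imp fun h => h.ne)
        simpa using List.inj_on_of_nodup_map hnd hp0 hp1 rfl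
      · exact absurd ⟨by simp, le_rfl⟩ (h4 _ hp1 _ hq0)
    · exact hq1
  unfold rects
  refine Finset.card_le_card_of_injOn (fun x => (x.1 + 1, x.2)) ?_ ?_
  · intro x hx
    simp only [Finset.coe_filter, Set.mem_ofPred_eq, List.mem_toFinset] at hx ⊢
    have key : ∀ a < k + 1, ∀ b < l + 1, (x.1 + 1 + a, x.2 + b) ∈ q := fun a ha b hb => by
      have e1 := hx.2 a (by omega) b hb
      have e2 := hx.2 (a + 1) (by omega) b hb
      rw [show x.1 + 1 + a = x.1 + a + 1 by omega]
      exact hmem _ _ e1 e2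
    exact ⟨key 0 (by omega) 0 (by omega), key⟩
  · intro x _ y _ e
    simp only [Prod.mk.injEq, Nat.add_right_cancel_iff] at e
    exact Prod.ext e.1 e.2

theorem Convex.toFinset_of_append {p q : List (ℕ × ℕ)} (hC : Convex C)
    (h : IsLinExt C (p ++ q)) : Convex q.toFinset := by
  obtain ⟨-, -, h3, h4⟩ := h.of_append
  intro x hx y hy z hxz hzy
  simp only [List.mem_toFinset] at hx hy ⊢
  rcases (h3 z).1 (hC x ((h3 x).2 (.inr hx)) y ((h3 y).2 (.inr hy)) z hxz hzy) with hz | hz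
  · exact absurd hxz (h4 z hz x hx)
  · exact hz

/-- Some linear extension of `C` has a descent word which is shared only by shapes with at most as
many `k × l` rectangles. -/
def HasExtremal (k l : ℕ) (C : Finset (ℕ × ℕ)) : Prop :=
  ∃ T, IsLinExt C T ∧ ∀ C' T', Convex C' → IsLinExt C' T' → T'.length = T.length →
    descents T' = descents T → rects k l C' ≤ rects k l C

/-- Column tops first, then an extremal extension of the rest. A competitor with the same word is
cut after equally many cells, and the two preceding bounds sandwich the inductive one. -/
theorem hasExtremal_succ {k l : ℕ} (h : ∀ C, Convex C → HasExtremal (k + 1) (l + 1) C)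
    (hC : Convex C) : HasExtremal (k + 2) (l + 1) C := by
  obtain ⟨p, hp, hpd⟩ := exists_isLinExt_tops hC
  obtain ⟨q, hq, hqm⟩ := h _ hC.sdiff_tops
  refine ⟨p ++ q, hp.append hq (fun x => ?_) fun x hx y hy => hC.not_le_tops hx hy, ?_⟩
  · by_cases hx : x ∈ tops C
    · simp [hx, (Finset.mem_filter.1 hx).1]
    · simp [hx]
  intro C' T' hC' hT' hlen hdesc
  have hT : T' = T'.take p.length ++ T'.drop p.length := (List.take_append_drop _ _).symm
  rw [List.length_append] at hlen
  have hlp : (T'.take p.length).length = p.length := by rw [List.length_take]; omega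
  rw [hT] at hdesc hT'
  obtain ⟨d1, d2⟩ := descents_append_inj hlp hdesc
  calc rects (k + 2) (l + 1) C' ≤ rects (k + 1) (l + 1) (T'.drop p.length).toFinset :=
        rects_le_of_append k l hT' (by rw [d1, hpd, hlp])
    _ ≤ rects (k + 1) (l + 1) (C \ tops C) :=
        hqm _ _ (hC'.toFinset_of_append hT') hT'.of_append.2.1 (by rw [List.length_drop]; omega) d2
    _ ≤ _ := rects_sdiff_tops_le k (l + 1) hC

theorem hasExtremal_image_swap {k l : ℕ} (h : ∀ C, Convex C → HasExtremal k l C)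
    (hC : Convex C) : HasExtremal l k C := by
  obtain ⟨T, hT, hTm⟩ := h _ hC.image_swap
  have hT2 := hT.map_swap
  rw [image_swap_image_swap] at hT2
  refine ⟨_, hT2, fun C' T' hC' hT' hlen hdesc => ?_⟩
  have := hTm _ _ hC'.image_swap hT'.map_swap (by simpa using hlen) (by
    rw [hT'.descents_map_swap hC', hdesc, hT.descents_map_swap hC.image_swap, List.map_map]
    simp [Function.comp_def])
  rwa [rects_image_swap, rects_image_swap] at this

/-- Height is raised one step at a time from the `1 × 1` case, where the count is the size.
Transposing the resulting `(l + 1) × 1` case gives `1 × (l + 1)`, from which the height is raised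
again. -/
theorem hasExtremal (k l : ℕ) : ∀ C, Convex C → HasExtremal (k + 1) (l + 1) C := by
  have h0 : ∀ C, Convex C → HasExtremal 1 1 C := by
    intro C _
    obtain ⟨T, hT⟩ := exists_isLinExt C
    refine ⟨T, hT, fun C' T' _ hT' hlen _ => ?_⟩
    rw [rects_one_one, rects_one_one, ← hT.length_eq, ← hT'.length_eq, hlen]
  have h1 : ∀ l, ∀ C, Convex C → HasExtremal (l + 1) 1 C := by
    intro l
    induction l with
    | zero => exact h0
    | succ l ih => exact fun C hC => hasExtremal_succ ih hC
  induction k with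
  | zero => exact fun C hC => hasExtremal_image_swap (h1 l) hC
  | succ k ih => exact fun C hC => hasExtremal_succ ih hC

theorem rects_le_of_words_subset {A B : Finset (ℕ × ℕ)} (hA : Convex A) (hB : Convex B)
    (hcard : A.card = B.card) (h : words B ⊆ words A) (k l : ℕ) :
    rects (k + 1) (l + 1) A ≤ rects (k + 1) (l + 1) B := by
  obtain ⟨T, hT, hTm⟩ := hasExtremal k l B hB
  obtain ⟨T', hT', hd⟩ := h ⟨T, hT, rfl⟩
  exact hTm A T' hA hT' (by rw [hT'.length_eq, hT.length_eq, hcard]) hd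

theorem rects_eq_of_words_eq {A B : Finset (ℕ × ℕ)} (hA : Convex A) (hB : Convex B)
    (hcard : A.card = B.card) (h : words A = words B) (k l : ℕ) :
    rects (k + 1) (l + 1) A = rects (k + 1) (l + 1) B :=
  le_antisymm (rects_le_of_words_subset hA hB hcard h.ge k l)
    (rects_le_of_words_subset hB hA hcard.symm h.le k l)

end CellSet

/-! ### Dominance order and truncated sums -/

theorem List.sum_take_le_sum_map_sub_add (t : ℕ) : ∀ (l : List ℕ) (k : ℕ),
    (l.take k).sum ≤ (l.map (· - t)).sum + k * t
  | [], k => by simp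
  | a :: l, 0 => by simp
  | a :: l, k + 1 => by
    have := List.sum_take_le_sum_map_sub_add t l k
    simp only [List.take_succ_cons, List.sum_cons, List.map_cons, add_mul, one_mul]
    omega

theorem List.sum_map_sub_eq_zero {t : ℕ} {l : List ℕ} (h : ∀ a ∈ l, a ≤ t) :
    (l.map (· - t)).sum = 0 := by
  rw [List.sum_eq_zero_iff]
  simp only [List.mem_map]
  rintro _ ⟨a, ha, rfl⟩
  exact Nat.sub_eq_zero_of_le (h a ha)

theorem List.exists_sum_map_sub_add_eq (t : ℕ) : ∀ {l : List ℕ}, l.Pairwise (· ≥ ·) →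
    ∃ k ≤ l.length, (l.map (· - t)).sum + k * t = (l.take k).sum
  | [], _ => ⟨0, by simp⟩
  | a :: l, h => by
    rw [List.pairwise_cons] at h
    rcases le_or_gt a t with hat | hat
    · refine ⟨0, by simp, ?_⟩
      rw [List.sum_map_sub_eq_zero]
      · simp
      · simp only [List.mem_cons, forall_eq_or_imp]
        exact ⟨hat, fun b hb => (h.1 b hb).trans hat⟩
    · obtain ⟨k, hk, e⟩ := List.exists_sum_map_sub_add_eq t h.2
      refine ⟨k + 1, by simpa using hk, ?_⟩
      simp only [List.take_succ_cons, List.sum_cons, List.map_cons, add_mul, one_mul]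
      omega

theorem List.exists_sum_take_eq : ∀ {l : List ℕ} (k : ℕ), l.Pairwise (· ≥ ·) →
    ∃ t, (t ∈ l ∨ t = 0) ∧ (l.take k).sum = (l.map (· - t)).sum + k * t
  | [], k, _ => ⟨0, by simp⟩
  | a :: l, 0, h => by
    rw [List.pairwise_cons] at h
    refine ⟨a, by simp, ?_⟩
    rw [List.sum_map_sub_eq_zero]
    · simp
    · simp only [List.mem_cons, forall_eq_or_imp]
      exact ⟨le_rfl, h.1⟩
  | a :: l, k + 1, h => by
    rw [List.pairwise_cons] at h
    obtain ⟨t, ht, e⟩ := List.exists_sum_take_eq k h.2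
    refine ⟨t, ht.imp_left (List.mem_cons_of_mem _), ?_⟩
    have hta : t ≤ a := by
      rcases ht with ht | rfl
      · exact h.1 t ht
      · exact Nat.zero_le _
    simp only [List.take_succ_cons, List.sum_cons, List.map_cons, add_mul, one_mul]
    omega

/-- Legendre duality: the sum of the first `k` parts is the minimum over `t` of the truncated sum
plus `k * t`, and the truncated sum at `t` is the maximum over `k` of the partial sum minus `k * t`.
The maximum is attained at the number of parts exceeding `t`, so only `k ≤ l.length` is needed. -/
theorem dominanceLE_iff {l m : List ℕ} (hl : l.Pairwise (· ≥ ·)) (hm : m.Pairwise (· ≥ ·)) :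
    DominanceLE l m ↔ ∀ t, (l.map (· - t)).sum ≤ (m.map (· - t)).sum := by
  constructor
  · intro h t
    obtain ⟨k, hk, e⟩ := List.exists_sum_map_sub_add_eq t hl
    have h1 := h k hk
    have h2 := List.sum_take_le_sum_map_sub_add t m k
    omega
  · intro h k _
    obtain ⟨t, _, e⟩ := List.exists_sum_take_eq k hm
    have h1 := h t
    have h2 := List.sum_take_le_sum_map_sub_add t l k
    omega

theorem List.sum_map_filter_pos_sub (t : ℕ) : ∀ l : List ℕ,
    ((l.filter (0 < ·)).map (· - t)).sum = (l.map (· - t)).sum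
  | [] => rfl
  | a :: l => by
    have := List.sum_map_filter_pos_sub t l
    rcases Nat.eq_zero_or_pos a with rfl | ha
    · simpa using this
    · simp [ha, this]

/-! ### Overlap partitions and rectangle counts -/

namespace SkewShape

variable (A : SkewShape)

theorem mem_cells {A : SkewShape} {i j : ℕ} :
    (i, j) ∈ A.cells ↔ A.inner.rowLen i ≤ j ∧ j < A.outer.rowLen i := by
  rw [cells, Finset.mem_sdiff, YoungDiagram.mem_cells, YoungDiagram.mem_cells,
    YoungDiagram.mem_iff_lt_rowLen, YoungDiagram.mem_iff_lt_rowLen, not_lt, and_comm]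

theorem convex_cells : CellSet.Convex A.cells := by
  rintro ⟨i, j⟩ hx ⟨i', j'⟩ hy ⟨a, b⟩ hxz hzy
  rw [mem_cells] at hx hy ⊢
  have h1 : i ≤ a := hxz.1
  have h2 : j ≤ b := hxz.2
  have h3 : a ≤ i' := hzy.1
  have h4 : b ≤ j' := hzy.2
  have h5 := A.inner.rowLen_anti i a h1
  have h6 := A.outer.rowLen_anti a i' h3
  omega

theorem forall_mem_cells_iff {k : ℕ} (i j : ℕ) :
    (∀ a < k + 1, (i + a, j) ∈ A.cells) ↔
      A.inner.rowLen i ≤ j ∧ j < A.outer.rowLen (i + k) := by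
  simp only [mem_cells]
  constructor
  · intro h
    exact ⟨(h 0 (by omega)).1, (h k (by omega)).2⟩
  · intro h a ha
    have h5 := A.inner.rowLen_anti i (i + a) (by omega)
    have h6 := A.outer.rowLen_anti (i + a) (i + k) (by omega)
    omega

/-- Rows move weakly to the left going down, so the common columns run from the start of the first
row to the end of the last one. -/
theorem overlap_succ (k i : ℕ) :
    A.overlap (k + 1) i = A.outer.rowLen (i + k) - A.inner.rowLen i := by
  unfold overlap
  simp only [forall_mem_cells_iff]
  rw [← Nat.card_Ico]
  congr 1
  ext j
  have := A.outer.rowLen_anti 0 (i + k) (by omega)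
  simp only [Finset.mem_filter, Finset.mem_range, Finset.mem_Ico]
  omega

/-- Rectangles are sorted by their top row. An interval of `n` common columns admits `n - t`
positions for a rectangle of width `t + 1`, which is why truncated subtraction is the right
operation. -/
theorem rects_cells (k t : ℕ) : CellSet.rects (k + 1) (t + 1) A.cells =
    ∑ i ∈ Finset.range (A.outer.colLen 0 + 1 - (k + 1)), (A.overlap (k + 1) i - t) := by
  have hrect : ∀ i j, (∀ a < k + 1, ∀ b < t + 1, (i + a, j + b) ∈ A.cells) ↔
      A.inner.rowLen i ≤ j ∧ j + t < A.outer.rowLen (i + k) := by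
    intro i j
    have : (∀ a < k + 1, ∀ b < t + 1, (i + a, j + b) ∈ A.cells) ↔
        ∀ b < t + 1, ∀ a < k + 1, (i + a, j + b) ∈ A.cells :=
      ⟨fun h b hb a ha => h a ha b hb, fun h a ha b hb => h b hb a ha⟩
    rw [this]
    simp only [forall_mem_cells_iff]
    constructor
    · intro h
      exact ⟨(h 0 (by omega)).1, (h t (by omega)).2⟩
    · intro h b hb
      omega
  have hR : ∀ i j, j < A.outer.rowLen i → i < A.outer.colLen 0 := by
    intro i j h
    rw [← YoungDiagram.mem_iff_lt_colLen, YoungDiagram.mem_iff_lt_rowLen]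
    omega
  unfold CellSet.rects
  rw [Finset.card_eq_sum_card_fiberwise (f := Prod.fst)
    (t := Finset.range (A.outer.colLen 0 + 1 - (k + 1)))]
  · refine Finset.sum_congr rfl fun i _ => ?_
    rw [overlap_succ, show A.outer.rowLen (i + k) - A.inner.rowLen i - t =
      A.outer.rowLen (i + k) - t - A.inner.rowLen i by omega, ← Nat.card_Ico,
      ← Finset.card_map (⟨fun j => (i, j), Prod.mk_right_injective i⟩ : ℕ ↪ ℕ × ℕ)]
    congr 1
    ext ⟨i', j⟩
    simp only [Finset.mem_filter, Finset.mem_map, Finset.mem_Ico, Function.Embedding.coeFn_mk,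
      Prod.mk.injEq, hrect]
    constructor
    · rintro ⟨⟨_, h⟩, rfl⟩
      exact ⟨j, by omega, rfl, rfl⟩
    · rintro ⟨j, h, rfl, rfl⟩
      have h6 := A.outer.rowLen_anti i (i + k) (by omega)
      exact ⟨⟨mem_cells.2 (by omega), by omega⟩, rfl⟩
  · rintro ⟨i, j⟩ h
    simp only [Finset.coe_filter, Set.mem_ofPred_eq, hrect] at h
    have := hR (i + k) (j + t) h.2.2
    simp only [Finset.coe_range, Set.mem_Iio]
    omega

theorem sum_map_rowsOverlap (k t : ℕ) : ((A.rowsOverlap (k + 1)).map (· - t)).sum =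
    CellSet.rects (k + 1) (t + 1) A.cells := by
  rw [rects_cells, rowsOverlap, ((List.perm_insertionSort _ _).map _).sum_eq,
    List.sum_map_filter_pos_sub, List.map_map]
  rfl

theorem forall_dominanceLE_rowsOverlap_iff (B : SkewShape) :
    (∀ k, 1 ≤ k → DominanceLE (A.rowsOverlap k) (B.rowsOverlap k)) ↔
      ∀ k l, CellSet.rects (k + 1) (l + 1) A.cells ≤ CellSet.rects (k + 1) (l + 1) B.cells := by
  have key : ∀ k, DominanceLE (A.rowsOverlap (k + 1)) (B.rowsOverlap (k + 1)) ↔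
      ∀ l, CellSet.rects (k + 1) (l + 1) A.cells ≤ CellSet.rects (k + 1) (l + 1) B.cells := by
    intro k
    have hs : ∀ D : SkewShape, (D.rowsOverlap (k + 1)).Pairwise (· ≥ ·) := fun D =>
      List.pairwise_insertionSort _ _
    rw [dominanceLE_iff (hs A) (hs B)]
    simp only [sum_map_rowsOverlap]
  constructor
  · intro h k
    exact (key k).1 (h (k + 1) (by omega))
  · rintro h (_ | k) hk
    · omega
    · exact (key k).2 (h k)

end SkewShape

/-! ### Uniqueness of expansions in fundamental quasisymmetric functions -/

namespace QSym

/-- The exponent of the monomial `x_0 ^ γ_0 x_1 ^ γ_1 ⋯`. -/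
noncomputable def exponent {n : ℕ} (γ : Composition n) : ℕ →₀ ℕ :=
  ∑ j : Fin γ.length, Finsupp.single (j : ℕ) (γ.blocksFun j)

theorem sum_single_apply {p : ℕ} {i : Fin p → ℕ} (hi : Function.Injective i) (b : Fin p → ℕ)
    (j : Fin p) : (∑ k, Finsupp.single (i k) (b k)) (i j) = b j := by
  rw [Finsupp.finsetSum_apply, Finset.sum_eq_single j]
  · simp
  · intro k _ hk
    exact Finsupp.single_eq_of_ne fun e => hk (hi e.symm)
  · simp

theorem support_sum_single {p : ℕ} {i : Fin p → ℕ} (hi : Function.Injective i) {b : Fin p → ℕ}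
    (hb : ∀ j, 0 < b j) :
    (∑ k, Finsupp.single (i k) (b k)).support = Finset.univ.image i := by
  ext x
  simp only [Finsupp.mem_support_iff, Finset.mem_image, Finset.mem_univ, true_and]
  constructor
  · intro h
    by_contra hx
    refine h ?_
    rw [Finsupp.finsetSum_apply]
    refine Finset.sum_eq_zero fun k _ => Finsupp.single_eq_of_ne fun e => hx ⟨k, e.symm⟩
  · rintro ⟨j, rfl⟩
    rw [sum_single_apply hi]
    exact (hb j).ne'

theorem monomial_exponent {n m : ℕ} (β : Composition n) (γ : Composition m) :
    monomial β (exponent γ) = if β.blocks = γ.blocks then 1 else 0 := by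
  classical
  unfold monomial
  congr 1
  rw [eq_iff_iff]
  constructor
  · rintro ⟨i, hi, e⟩
    have hs := congrArg Finsupp.support e
    rw [exponent, support_sum_single Fin.val_injective γ.one_le_blocksFun,
      support_sum_single hi.injective β.one_le_blocksFun] at hs
    have hlen : γ.length = β.length := by
      have := congrArg Finset.card hs
      rwa [Finset.card_image_of_injective _ Fin.val_injective,
        Finset.card_image_of_injective _ hi.injective, Finset.card_fin, Finset.card_fin] at this
    have hrange : (Finset.univ.image i) = Finset.range β.length := by
      rw [← hs]
      ext x
      simp only [Finset.mem_image, Finset.mem_univ, true_and, Finset.mem_range, ← hlen]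
      exact ⟨fun ⟨j, hj⟩ => hj ▸ j.2, fun hx => ⟨⟨x, hx⟩, rfl⟩⟩
    -- An initial segment of the natural numbers has only one strictly increasing enumeration.
    have hival : i = fun j : Fin β.length => (j : ℕ) := by
      have h1 := Finset.orderEmbOfFin_unique (s := Finset.range β.length) (k := β.length)
        (by simp) (f := i) (fun x => by rw [← hrange]; simp) hi
      have h2 := Finset.orderEmbOfFin_unique (s := Finset.range β.length) (k := β.length)
        (by simp) (f := fun j : Fin β.length => (j : ℕ)) (fun x => by simp)
        Fin.val_strictMono
      rw [h1, h2]
    refine List.ext_getElem hlen.symm fun k h1 h2 => ?_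
    have e1 := sum_single_apply hi.injective β.blocksFun ⟨k, h1⟩
    have e2 := sum_single_apply (Fin.val_injective (n := γ.length)) γ.blocksFun ⟨k, h2⟩
    rw [← e] at e1
    rw [hival] at e1
    change (exponent γ) k = _ at e2
    exact e1.symm.trans e2
  · intro h
    have hnm : n = m := by rw [← β.blocks_sum, h, γ.blocks_sum]
    subst hnm
    obtain rfl : β = γ := Composition.ext h
    exact ⟨fun j => j, Fin.val_strictMono, rfl⟩

theorem fundamental_exponent {n : ℕ} (α γ : Composition n) :
    MvPowerSeries.coeff (exponent γ) (fundamental α) =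
      if subsetEquiv n α ⊆ subsetEquiv n γ then 1 else 0 := by
  classical
  unfold fundamental
  rw [map_sum]
  have : ∀ β : Composition n, MvPowerSeries.coeff (exponent γ) (monomial β) =
      if β = γ then 1 else 0 := fun β =>
    (monomial_exponent β γ).trans (by congr 1; rw [eq_iff_iff]; exact Composition.ext_iff.symm)
  simp only [this]
  rw [Finset.sum_ite_eq']
  simp

theorem fundamental_exponent_of_ne {n m : ℕ} (h : n ≠ m) (α : Composition n) (γ : Composition m) :
    MvPowerSeries.coeff (exponent γ) (fundamental α) = 0 := by
  classical
  unfold fundamental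
  rw [map_sum]
  refine Finset.sum_eq_zero fun β _ => (monomial_exponent β γ).trans (if_neg fun e => h ?_)
  rw [← β.blocks_sum, e, γ.blocks_sum]

/-- The coefficient of the monomial of `α` only sees those `β` with `S(β) ⊆ S(α)`, so the system is
unitriangular and coefficients vanish by induction on the size of `S(α)`. -/
theorem linearIndependent_fundamental :
    LinearIndependent ℚ fun α : Σ n, Composition n => fundamental α.2 := by
  rw [linearIndependent_iff]
  intro c hc
  suffices ∀ s n (α : Composition n), (subsetEquiv n α).card = s → c ⟨n, α⟩ = 0 by
    ext ⟨n, α⟩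
    exact this _ n α rfl
  intro s
  induction s using Nat.strong_induction_on with
  | _ s ih =>
    intro n α hs
    have h := congrArg (MvPowerSeries.coeff (exponent α)) hc
    rw [Finsupp.linearCombination_apply, Finsupp.sum, map_sum, map_zero] at h
    simp only [map_smul, smul_eq_mul] at h
    rw [Finset.sum_eq_single ⟨n, α⟩] at h
    · simpa [fundamental_exponent] using h
    · rintro ⟨m, β⟩ _ hne
      by_cases hm : m = n
      · subst hm
        rw [fundamental_exponent]
        split_ifs with hsub
        · have hβ : β ≠ α := fun e => hne (by rw [e])
          have hss := hsub.ssubset_of_ne fun e => hβ ((subsetEquiv m).injective e)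
          rw [ih _ (hs ▸ Finset.card_lt_card hss) m β rfl, zero_mul]
        · simp
      · rw [fundamental_exponent_of_ne hm, mul_zero]
    · intro hn
      rw [Finsupp.notMem_support_iff.1 hn, zero_mul]

theorem IsFExpansion.unique {f : MvPowerSeries ℕ ℚ} {c d : (Σ n, Composition n) →₀ ℚ}
    (hc : IsFExpansion f c) (hd : IsFExpansion f d) : c = d :=
  linearIndependent_fundamental <| by
    rw [Finsupp.linearCombination_apply, Finsupp.linearCombination_apply]
    exact hc.symm.trans hd

/-- A composition of `n` as a word: `S(α)` as its indicator function. -/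
def word (α : Σ n, Composition n) : List Bool :=
  List.ofFn fun i => decide (i ∈ subsetEquiv α.1 α.2)

/-- The size has to be kept: the compositions of 0 and of 1 both have the empty word. -/
theorem word_injective : Function.Injective fun α : Σ n, Composition n => (α.1, word α) := by
  rintro ⟨n, α⟩ ⟨m, β⟩ h
  simp only [Prod.mk.injEq] at h
  obtain ⟨rfl, h⟩ := h
  have := List.ofFn_injective h
  simp only [Sigma.mk.injEq, heq_eq_eq, true_and]
  refine (subsetEquiv n).injective (Finset.ext fun i => ?_)
  simpa using congrFun this i

end QSym

/-! ### Standard tableaux as linear extensions -/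

namespace CellSet

theorem getElem_descents : ∀ (l : List (ℕ × ℕ)) (t : ℕ) (h : t < (descents l).length)
    (h' : t + 1 < l.length), (descents l)[t] = decide (l[t].1 < l[t + 1].1)
  | x :: y :: l, 0, _, _ => rfl
  | x :: y :: l, t + 1, h, h' => by
    have := getElem_descents (y :: l) t (by simpa using h) (by simpa using h')
    simpa using this

end CellSet

namespace SkewShape

variable {A : SkewShape}

/-- The cells in the order of their entries. -/
def SYT.toList (T : A.SYT) : List (ℕ × ℕ) := List.ofFn fun t => (T.1.symm t).1

theorem SYT.lt_of_le_of_ne (T : A.SYT) (c d : {c // c ∈ A.cells}) (h : c.1 ≤ d.1) (hne : c ≠ d) :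
    T.1 c < T.1 d := by
  obtain ⟨⟨i, j⟩, hc⟩ := c
  obtain ⟨⟨i', j'⟩, hd⟩ := d
  obtain ⟨h1, h2⟩ := h
  simp only at h1 h2
  -- This corner lets a comparison of two cells be composed of one step along a row and one down a
  -- column.
  have he : (i, j') ∈ A.cells :=
    convex_cells A _ hc _ hd _ ⟨le_rfl, h2⟩ ⟨h1, le_rfl⟩
  rcases h1.eq_or_lt with rfl | h1
  · rcases h2.eq_or_lt with rfl | h2
    · exact absurd rfl hne
    · exact T.2.1 _ _ rfl h2
  · rcases h2.eq_or_lt with rfl | h2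
    · exact T.2.2 _ _ rfl h1
    · exact (T.2.1 ⟨_, hc⟩ ⟨_, he⟩ rfl h2).trans (T.2.2 ⟨_, he⟩ ⟨_, hd⟩ rfl h1)

theorem SYT.isLinExt_toList (T : A.SYT) : CellSet.IsLinExt A.cells T.toList := by
  constructor
  · intro x
    rw [SYT.toList, List.mem_ofFn]
    constructor
    · rintro ⟨t, rfl⟩
      exact (T.1.symm t).2
    · intro hx
      exact ⟨T.1 ⟨x, hx⟩, by simp⟩
  · rw [SYT.toList, List.pairwise_ofFn]
    intro i j hij hle
    have := T.lt_of_le_of_ne _ _ hle fun e => hij.ne' (T.1.symm.injective e)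
    simp only [Equiv.apply_symm_apply] at this
    exact absurd this hij.asymm

theorem SYT.exists_toList_eq {l : List (ℕ × ℕ)} (h : CellSet.IsLinExt A.cells l) :
    ∃ T : A.SYT, T.toList = l := by
  have hlen : l.length = A.size := h.length_eq
  let f : Fin A.size → {c // c ∈ A.cells} := fun t =>
    ⟨l[(t : ℕ)]'(by rw [hlen]; exact t.2), (h.mem_iff _).1 (List.getElem_mem _)⟩
  have hf : Function.Bijective f := by
    rw [Fintype.bijective_iff_injective_and_card]
    refine ⟨fun s t e => ?_, by rw [Fintype.card_fin, Fintype.card_coe]; rfl⟩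
    have := congrArg Subtype.val e
    exact Fin.ext ((List.Nodup.getElem_inj_iff h.nodup).1 this)
  let e := Equiv.ofBijective f hf
  have key : ∀ c d : {c // c ∈ A.cells}, c.1 ≤ d.1 → c ≠ d → e.symm c < e.symm d := by
    intro c d hle hne
    by_contra hlt
    have hlt : e.symm d < e.symm c := (not_lt.1 hlt).lt_of_ne fun h =>
      hne (e.symm.injective h.symm)
    have := (List.pairwise_iff_getElem.1 h.pairwise) (e.symm d) (e.symm c)
      (by rw [hlen]; exact (e.symm d).2) (by rw [hlen]; exact (e.symm c).2) hlt
    have hc : l[(e.symm c : ℕ)]'(by rw [hlen]; exact (e.symm c).2) = c.1 :=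
      congrArg Subtype.val (e.apply_symm_apply c)
    have hd : l[(e.symm d : ℕ)]'(by rw [hlen]; exact (e.symm d).2) = d.1 :=
      congrArg Subtype.val (e.apply_symm_apply d)
    rw [hc, hd] at this
    exact this hle
  refine ⟨⟨e.symm, fun c d h1 h2 => key c d ⟨h1.le, h2.le⟩ ?_, fun c d h1 h2 =>
    key c d ⟨h2.le, h1.le⟩ ?_⟩, ?_⟩
  · rintro rfl; exact lt_irrefl _ h2
  · rintro rfl; exact lt_irrefl _ h2
  · refine List.ext_getElem (by simp [SYT.toList, hlen]) fun k h1 h2 => ?_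
    simp [SYT.toList, e, f]

theorem SYT.word_descentComposition (T : A.SYT) :
    QSym.word ⟨A.size, T.descentComposition⟩ = CellSet.descents T.toList := by
  refine List.ext_getElem ?_ fun k h1 h2 => ?_
  · simp [QSym.word, CellSet.length_descents, SYT.toList]
  · rw [CellSet.getElem_descents _ _ h2 (by
      rw [CellSet.length_descents] at h2
      omega)]
    simp only [QSym.word, SYT.descentComposition, SYT.descentSet, SYT.toList, SYT.rowOf,
      Equiv.apply_symm_apply, List.getElem_ofFn, decide_eq_decide]
    exact Finset.mem_filter_univ _

/-- The coefficients of the `F`-expansion of `s_A`. -/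
noncomputable def coefficients (A : SkewShape) : (Σ n, Composition n) →₀ ℚ :=
  ∑ T : A.SYT, Finsupp.single ⟨A.size, T.descentComposition⟩ 1

theorem isFExpansion_coefficients (A : SkewShape) :
    QSym.IsFExpansion A.schur A.coefficients := by
  unfold QSym.IsFExpansion coefficients schur
  rw [← Finsupp.linearCombination_apply (R := ℚ)
    (v := fun α : Σ n, Composition n => QSym.fundamental α.2), map_sum]
  simp

/-- As a number of tableaux, a coefficient is positive as soon as one tableau exists, and being at
most 1 means that the tableau is unique. -/
theorem coefficients_apply (A : SkewShape) (α : Σ n, Composition n)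
    [DecidableEq (Σ n, Composition n)] :
    A.coefficients α =
      (Finset.univ.filter fun T : A.SYT => (⟨A.size, T.descentComposition⟩ : Σ m, Composition m) = α).card := by
  rw [coefficients, Finsupp.finsetSum_apply]
  simp [Finsupp.single_apply]

theorem mem_fSupport {α : Σ n, Composition n} :
    α ∈ A.fSupport ↔ ∃ T : A.SYT, (⟨A.size, T.descentComposition⟩ : Σ m, Composition m) = α := by
  classical
  have : α ∈ A.fSupport ↔ 0 < A.coefficients α := by
    constructor
    · rintro ⟨c, hc, h⟩
      rwa [← hc.unique A.isFExpansion_coefficients]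
    · exact fun h => ⟨_, A.isFExpansion_coefficients, h⟩
  rw [this, coefficients_apply, Nat.cast_pos, Finset.card_pos]
  simp [Finset.Nonempty]

theorem image_word_fSupport :
    (fun α : Σ n, Composition n => (α.1, QSym.word α)) '' A.fSupport =
      {A.size} ×ˢ CellSet.words A.cells := by
  ext ⟨n, w⟩
  simp only [Set.mem_image, mem_fSupport, Set.mem_prod, Set.mem_singleton_iff]
  constructor
  · rintro ⟨_, ⟨T, rfl⟩, h⟩
    simp only [Prod.mk.injEq] at h
    exact ⟨h.1.symm, T.toList, T.isLinExt_toList, by rw [← h.2, T.word_descentComposition]⟩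
  · rintro ⟨rfl, l, hl, rfl⟩
    obtain ⟨T, rfl⟩ := SYT.exists_toList_eq hl
    exact ⟨_, ⟨T, rfl⟩, by rw [T.word_descentComposition]⟩

theorem fSupport_subset_iff {B : SkewShape} (h : A.size = B.size) :
    B.fSupport ⊆ A.fSupport ↔ CellSet.words B.cells ⊆ CellSet.words A.cells := by
  rw [← Set.image_subset_image_iff QSym.word_injective, image_word_fSupport,
    image_word_fSupport, h]
  constructor
  · intro hs w hw
    exact (hs (a := (B.size, w)) ⟨rfl, hw⟩).2
  · exact fun hs => Set.prod_mono_right hs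

theorem FMultiplicityFree.multFree (h : A.FMultiplicityFree) : CellSet.MultFree A.cells := by
  classical
  obtain ⟨c, hc, h01⟩ := h
  rw [hc.unique A.isFExpansion_coefficients] at h01
  intro l₁ l₂ h₁ h₂ e
  obtain ⟨T₁, rfl⟩ := SYT.exists_toList_eq h₁
  obtain ⟨T₂, rfl⟩ := SYT.exists_toList_eq h₂
  rw [← T₁.word_descentComposition, ← T₂.word_descentComposition] at e
  have e' : (⟨A.size, T₁.descentComposition⟩ : Σ n, Composition n) =
      ⟨A.size, T₂.descentComposition⟩ := QSym.word_injective (Prod.ext rfl e)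
  have hle : A.coefficients ⟨A.size, T₂.descentComposition⟩ ≤ 1 := by
    rcases h01 ⟨A.size, T₂.descentComposition⟩ with h | h <;> simp [h]
  rw [coefficients_apply, Nat.cast_le_one, Finset.card_le_one] at hle
  rw [hle T₁ (by simpa using e') T₂ (by simp)]

end SkewShape

namespace CellSet

variable {C : Finset (ℕ × ℕ)}

/-! ### Skew shapes with at most two minimal and at most two maximal cells -/

/-- The `h × w` rectangle, without the cells of the first `S` rows in the first `u` columns, and
without the cells from row `P` on in columns from `v` on. -/
def shape (h w S u P v : ℕ) : Finset (ℕ × ℕ) :=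
  (Finset.range h ×ˢ Finset.range w).filter fun x => (x.1 < S → u ≤ x.2) ∧ (P ≤ x.1 → x.2 < v)

theorem mem_shape {h w S u P v i j : ℕ} : (i, j) ∈ shape h w S u P v ↔
    i < h ∧ j < w ∧ (i < S → u ≤ j) ∧ (P ≤ i → j < v) := by
  simp [shape, and_assoc]

theorem convex_shape (h w S u P v : ℕ) : Convex (shape h w S u P v) := by
  rintro ⟨i, j⟩ hx ⟨i', j'⟩ hy ⟨a, b⟩ hxz hzy
  rw [mem_shape] at hx hy ⊢
  have h1 : i ≤ a := hxz.1
  have h2 : j ≤ b := hxz.2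
  have h3 : a ≤ i' := hzy.1
  have h4 : b ≤ j' := hzy.2
  omega

theorem not_multFree_of_lists {l₁ l₂ : List (ℕ × ℕ)} (h₁ : l₁.toFinset = C)
    (h₁' : l₁.Pairwise fun a b => ¬ b ≤ a) (h₂ : l₂.toFinset = C)
    (h₂' : l₂.Pairwise fun a b => ¬ b ≤ a) (hd : descents l₁ = descents l₂) (hne : l₁ ≠ l₂) :
    ¬ MultFree C := fun h =>
  hne (h _ _ ⟨fun x => by rw [← h₁, List.mem_toFinset], h₁'⟩
    ⟨fun x => by rw [← h₂, List.mem_toFinset], h₂'⟩ hd)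

/-! ### Minimal obstructions: two linear extensions with equal words -/

theorem not_multFree_shape_3_3_0_0_3_3 : ¬ MultFree (shape 3 3 0 0 3 3) :=
  not_multFree_of_lists (l₁ := [(0, 0), (0, 1), (1, 0), (0, 2), (2, 0), (1, 1), (2, 1), (1, 2), (2, 2)])
    (l₂ := [(0, 0), (0, 1), (1, 0), (1, 1), (2, 0), (0, 2), (2, 1), (1, 2), (2, 2)])
    (by decide) (by decide) (by decide) (by decide) (by decide) (by decide)

theorem not_multFree_shape_2_5_0_0_2_5 : ¬ MultFree (shape 2 5 0 0 2 5) :=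
  not_multFree_of_lists (l₁ := [(0, 0), (0, 1), (1, 0), (0, 2), (0, 3), (1, 1), (1, 2), (0, 4), (1, 3), (1, 4)])
    (l₂ := [(0, 0), (0, 1), (1, 0), (1, 1), (0, 2), (1, 2), (0, 3), (0, 4), (1, 3), (1, 4)])
    (by decide) (by decide) (by decide) (by decide) (by decide) (by decide)

theorem not_multFree_shape_5_2_0_0_5_2 : ¬ MultFree (shape 5 2 0 0 5 2) :=
  not_multFree_of_lists (l₁ := [(0, 0), (1, 0), (0, 1), (1, 1), (2, 0), (2, 1), (3, 0), (4, 0), (3, 1), (4, 1)])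
    (l₂ := [(0, 0), (1, 0), (0, 1), (2, 0), (3, 0), (1, 1), (2, 1), (4, 0), (3, 1), (4, 1)])
    (by decide) (by decide) (by decide) (by decide) (by decide) (by decide)

theorem not_multFree_shape_2_4_0_0_1_3 : ¬ MultFree (shape 2 4 0 0 1 3) :=
  not_multFree_of_lists (l₁ := [(0, 0), (0, 1), (1, 0), (0, 2), (0, 3), (1, 1), (1, 2)])
    (l₂ := [(0, 0), (0, 1), (1, 0), (1, 1), (0, 2), (1, 2), (0, 3)])
    (by decide) (by decide) (by decide) (by decide) (by decide) (by decide)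

theorem not_multFree_shape_3_3_0_0_1_2 : ¬ MultFree (shape 3 3 0 0 1 2) :=
  not_multFree_of_lists (l₁ := [(0, 0), (0, 1), (1, 0), (0, 2), (2, 0), (1, 1), (2, 1)])
    (l₂ := [(0, 0), (0, 1), (1, 0), (1, 1), (2, 0), (0, 2), (2, 1)])
    (by decide) (by decide) (by decide) (by decide) (by decide) (by decide)

theorem not_multFree_shape_3_3_0_0_2_1 : ¬ MultFree (shape 3 3 0 0 2 1) :=
  not_multFree_of_lists (l₁ := [(0, 0), (0, 1), (1, 0), (0, 2), (1, 1), (1, 2), (2, 0)])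
    (l₂ := [(0, 0), (0, 1), (1, 0), (1, 1), (2, 0), (0, 2), (1, 2)])
    (by decide) (by decide) (by decide) (by decide) (by decide) (by decide)

theorem not_multFree_shape_3_3_0_0_2_2 : ¬ MultFree (shape 3 3 0 0 2 2) :=
  not_multFree_of_lists (l₁ := [(0, 0), (0, 1), (1, 0), (0, 2), (1, 1), (1, 2), (2, 0), (2, 1)])
    (l₂ := [(0, 0), (0, 1), (1, 0), (0, 2), (2, 0), (1, 1), (2, 1), (1, 2)])
    (by decide) (by decide) (by decide) (by decide) (by decide) (by decide)

theorem not_multFree_shape_4_2_0_0_3_1 : ¬ MultFree (shape 4 2 0 0 3 1) :=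
  not_multFree_of_lists (l₁ := [(0, 0), (1, 0), (0, 1), (1, 1), (2, 0), (2, 1), (3, 0)])
    (l₂ := [(0, 0), (1, 0), (0, 1), (2, 0), (3, 0), (1, 1), (2, 1)])
    (by decide) (by decide) (by decide) (by decide) (by decide) (by decide)

theorem not_multFree_shape_3_3_2_1_2_1 : ¬ MultFree (shape 3 3 2 1 2 1) :=
  not_multFree_of_lists (l₁ := [(0, 1), (1, 1), (0, 2), (2, 0), (1, 2)])
    (l₂ := [(0, 1), (2, 0), (0, 2), (1, 1), (1, 2)])
    (by decide) (by decide) (by decide) (by decide) (by decide) (by decide)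

theorem not_multFree_shape_4_2_2_1_2_1 : ¬ MultFree (shape 4 2 2 1 2 1) :=
  not_multFree_of_lists (l₁ := [(0, 1), (2, 0), (1, 1), (3, 0)])
    (l₂ := [(2, 0), (3, 0), (0, 1), (1, 1)])
    (by decide) (by decide) (by decide) (by decide) (by decide) (by decide)

theorem not_multFree_shape_2_4_1_2_1_2 : ¬ MultFree (shape 2 4 1 2 1 2) :=
  not_multFree_of_lists (l₁ := [(0, 2), (0, 3), (1, 0), (1, 1)])
    (l₂ := [(1, 0), (0, 2), (1, 1), (0, 3)])
    (by decide) (by decide) (by decide) (by decide) (by decide) (by decide)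

theorem not_multFree_shape_3_3_1_2_1_2 : ¬ MultFree (shape 3 3 1 2 1 2) :=
  not_multFree_of_lists (l₁ := [(1, 0), (0, 2), (2, 0), (1, 1), (2, 1)])
    (l₂ := [(1, 0), (1, 1), (2, 0), (0, 2), (2, 1)])
    (by decide) (by decide) (by decide) (by decide) (by decide) (by decide)

theorem not_multFree_shape_3_3_1_1_2_2 : ¬ MultFree (shape 3 3 1 1 2 2) :=
  not_multFree_of_lists (l₁ := [(0, 1), (1, 0), (0, 2), (1, 1), (1, 2), (2, 0), (2, 1)])
    (l₂ := [(0, 1), (1, 0), (0, 2), (2, 0), (1, 1), (2, 1), (1, 2)])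
    (by decide) (by decide) (by decide) (by decide) (by decide) (by decide)

theorem not_multFree_shape_4_2_1_1_3_1 : ¬ MultFree (shape 4 2 1 1 3 1) :=
  not_multFree_of_lists (l₁ := [(1, 0), (0, 1), (1, 1), (2, 0), (2, 1), (3, 0)])
    (l₂ := [(1, 0), (0, 1), (2, 0), (3, 0), (1, 1), (2, 1)])
    (by decide) (by decide) (by decide) (by decide) (by decide) (by decide)

/-- A long middle row with one cell above its last column and one below its first. A window cannot
shorten the row and keep both extra cells, so every length is treated: fill the row up to column `m
- 1`, then finish in two ways with the same word. -/
theorem not_multFree_shape_staircase (m : ℕ) : ¬ MultFree (shape 3 (m + 2) 1 (m + 1) 2 1) := by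
  have hmem : ∀ x : ℕ × ℕ, x ∈ shape 3 (m + 2) 1 (m + 1) 2 1 ↔
      (x.1 = 1 ∧ x.2 < m) ∨ x = (0, m + 1) ∨ x = (1, m) ∨ x = (1, m + 1) ∨ x = (2, 0) := by
    rintro ⟨i, j⟩
    simp only [mem_shape, Prod.mk.injEq]
    omega
  have hpre : ∀ x : ℕ × ℕ, x ∈ (List.range m).map (fun j => (1, j)) ↔ x.1 = 1 ∧ x.2 < m := by
    rintro ⟨i, j⟩
    simp only [List.mem_map, List.mem_range, Prod.mk.injEq]
    exact ⟨fun ⟨a, h1, h2, h3⟩ => ⟨h2.symm, h3 ▸ h1⟩, fun ⟨h1, h2⟩ => ⟨j, h2, h1.symm, rfl⟩⟩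
  have hpw : ((List.range m).map (fun j => (1, j))).Pairwise fun a b : ℕ × ℕ => ¬ b ≤ a := by
    rw [List.pairwise_map]
    exact List.pairwise_lt_range.imp fun h hle => by have := hle.2; simp at this; omega
  have hext : ∀ q : List (ℕ × ℕ), q.Pairwise (fun a b => ¬ b ≤ a) →
      (∀ x, x ∈ q ↔ x = (0, m + 1) ∨ x = (1, m) ∨ x = (1, m + 1) ∨ x = (2, 0)) →
      IsLinExt (shape 3 (m + 2) 1 (m + 1) 2 1) ((List.range m).map (fun j => (1, j)) ++ q) := by
    intro q h1 h2
    refine ⟨fun x => by rw [List.mem_append, hpre, h2, hmem], ?_⟩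
    rw [List.pairwise_append]
    refine ⟨hpw, h1, ?_⟩
    rintro ⟨a, b⟩ ha ⟨c, d⟩ hc hle
    rw [hpre] at ha
    rw [h2] at hc
    have e1 : c ≤ a := hle.1
    have e2 : d ≤ b := hle.2
    simp only [Prod.mk.injEq] at hc ha
    omega
  have hdesc : ∀ (y : ℕ × ℕ) (q : List (ℕ × ℕ)), y.1 ≤ 1 →
      descents ((List.range m).map (fun j => (1, j)) ++ y :: q) =
      descents ((List.range m).map (fun j => (1, j))) ++ (if m = 0 then [] else [false]) ++
        descents (y :: q) := by
    intro y q hy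
    rw [descents_append_of_forall (β := false)]
    · simp
    · intro x hx y' hy'
      rw [hpre] at hx
      simp only [List.head?_cons, Option.mem_def, Option.some.injEq] at hy'
      subst hy'
      rw [decide_eq_false_iff_not]
      omega
  intro h
  have := h _ _
    (hext [(0, m + 1), (1, m), (1, m + 1), (2, 0)] (by simp) (by simp))
    (hext [(1, m), (2, 0), (0, m + 1), (1, m + 1)] (by simp) (fun x => by simp; tauto))
    (by rw [hdesc _ _ (by simp), hdesc _ _ (by simp)]; simp)
  simp at this

end CellSet

/-! ### Windows, minimal and maximal cells, and deletion of empty lines -/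

namespace CellSet

variable {C D : Finset (ℕ × ℕ)}

/-- Multiplicity-freeness passes to the part of a shape in a window of consecutive rows and
columns. -/
theorem MultFree.window (h : MultFree C) (hC : Convex C) (r c a b : ℕ)
    (hD : ∀ i j, (i, j) ∈ D ↔ i < a ∧ j < b ∧ (r + i, c + j) ∈ C) : MultFree D := by
  have h1 := (h.filter_row r).2
  have c1 : Convex (C.filter fun x => r ≤ x.1) :=
    hC.filter fun x y z hx _ hxz _ => le_trans hx hxz.1
  have h2 := (h1.filter_row (r + a)).1
  have c2 := c1.filter (P := fun x => x.1 < r + a)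
    fun x y z _ hy _ hzy => lt_of_le_of_lt hzy.1 hy
  have h3 := (h2.filter_col c2 c).2
  have c3 := c2.filter (P := fun x => c ≤ x.2) fun x y z hx _ hxz _ => le_trans hx hxz.2
  have h4 := (h3.filter_col c3 (c + b)).1
  refine IsIso.multFree (φ := fun x => (x.1 - r, x.2 - c)) ⟨?_, ?_, ?_, ?_⟩ h4
  · rintro ⟨i, j⟩ hx
    simp only [Finset.mem_filter] at hx
    rw [hD]
    refine ⟨by omega, by omega, ?_⟩
    rw [Nat.add_sub_cancel' hx.1.1.1.2, Nat.add_sub_cancel' hx.1.2]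
    exact hx.1.1.1.1
  · rintro ⟨i, j⟩ hy
    rw [hD] at hy
    refine ⟨(r + i, c + j), ?_, by simp⟩
    simp only [Finset.mem_filter]
    exact ⟨⟨⟨⟨hy.2.2, by omega⟩, by omega⟩, by omega⟩, by omega⟩
  · rintro ⟨i, j⟩ hx ⟨i', j'⟩ hy
    simp only [Finset.mem_filter] at hx hy
    simp only [Prod.mk_le_mk]
    omega
  · rintro ⟨i, j⟩ hx ⟨i', j'⟩ hy
    simp only [Finset.mem_filter] at hx hy
    simp only
    omega

theorem MultFree.shape_window {h w S u P v h' w' S' u' P' v' : ℕ}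
    (hM : MultFree (shape h w S u P v)) (r c : ℕ)
    (hD : ∀ i j, i < h' → j < w' → ((i < S' → u' ≤ j) ∧ (P' ≤ i → j < v') ↔
      r + i < h ∧ c + j < w ∧ (r + i < S → u ≤ c + j) ∧ (P ≤ r + i → c + j < v))) :
    MultFree (shape h' w' S' u' P' v') := by
  refine hM.window (convex_shape _ _ _ _ _ _) r c h' w' fun i j => ?_
  rw [mem_shape, mem_shape]
  constructor
  · rintro ⟨h1, h2, h3⟩
    exact ⟨h1, h2, (hD i j h1 h2).1 h3⟩
  · rintro ⟨h1, h2, h3⟩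
    exact ⟨h1, h2, (hD i j h1 h2).2 h3⟩

/-- A shape with three minimal cells is not multiplicity-free. -/
theorem MultFree.not_three_minimal (h : MultFree C) {a b c : ℕ × ℕ}
    (ha : Minimal (· ∈ C) a) (hb : Minimal (· ∈ C) b) (hc : Minimal (· ∈ C) c)
    (hab : b.2 < a.2) (hbc : c.2 < b.2) : False := by
  have row : ∀ {x y : ℕ × ℕ}, x ∈ C → Minimal (· ∈ C) y → x.2 < y.2 → y.1 < x.1 := by
    intro x y hx hy hxy
    by_contra hle
    have := hy.le_of_le hx ⟨not_lt.1 hle, hxy.le⟩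
    exact absurd this.2 (not_le.2 hxy)
  have rab := row hb.prop ha hab
  have rbc := row hc.prop hb hbc
  -- Minimal cells may come first in any order, followed by one fixed completion `s`.
  obtain ⟨s, hs⟩ := exists_isLinExt (C \ {a, b, c})
  have key : ∀ x y z : ℕ × ℕ, ({x, y, z} : Finset (ℕ × ℕ)) = {a, b, c} →
      ¬ y ≤ x → ¬ z ≤ x → ¬ z ≤ y → IsLinExt C ([x, y, z] ++ s) := by
    intro x y z e h1 h2 h3
    have hsub : ∀ t ∈ ({x, y, z} : Finset (ℕ × ℕ)), Minimal (· ∈ C) t := by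
      rw [e]
      simp only [Finset.mem_insert, Finset.mem_singleton]
      rintro t (rfl | rfl | rfl) <;> assumption
    rw [← e] at hs
    refine IsLinExt.append (X := {x, y, z}) ⟨by simp, by simp [h1, h2, h3]⟩ hs (fun t => ?_) ?_
    · by_cases ht : t ∈ ({x, y, z} : Finset (ℕ × ℕ))
      · simp only [ht, true_or, iff_true]
        exact (hsub t ht).prop
      · simp [ht, Finset.mem_sdiff]
    · intro t ht t' ht' hle
      rw [Finset.mem_sdiff] at ht'
      have := (hsub t ht).eq_of_ge ht'.1 hle
      exact ht'.2 (this ▸ ht)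
  have nle : ∀ x y : ℕ × ℕ, x.1 < y.1 ∨ x.2 < y.2 → ¬ y ≤ x := by
    intro x y hxy hle
    have := hle.1
    have := hle.2
    omega
  have e1 : ({b, a, c} : Finset (ℕ × ℕ)) = {a, b, c} := by ext; simp; tauto
  have e2 : ({c, a, b} : Finset (ℕ × ℕ)) = {a, b, c} := by ext; simp; tauto
  have e3 : ({a, c, b} : Finset (ℕ × ℕ)) = {a, b, c} := by ext; simp; tauto
  have e4 : ({b, c, a} : Finset (ℕ × ℕ)) = {a, b, c} := by ext; simp; tauto
  have k1 := key b a c e1 (nle _ _ (by omega)) (nle _ _ (by omega)) (nle _ _ (by omega))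
  have k2 := key c a b e2 (nle _ _ (by omega)) (nle _ _ (by omega)) (nle _ _ (by omega))
  have k3 := key a c b e3 (nle _ _ (by omega)) (nle _ _ (by omega)) (nle _ _ (by omega))
  have k4 := key b c a e4 (nle _ _ (by omega)) (nle _ _ (by omega)) (nle _ _ (by omega))
  have hbc' : b ≠ c := fun e => by rw [e] at rbc; omega
  have hab' : a ≠ b := fun e => by rw [e] at rab; omega
  have n1 : ¬ b.1 < a.1 := by omega
  have n2 : ¬ c.1 < a.1 := by omega
  have n3 : ¬ c.1 < b.1 := by omega
  have p1 : a.1 < c.1 := by omega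
  cases s with
  | nil =>
    have := h _ _ k1 k2 (by simp [n1, n2, p1, rab])
    simp [hbc'] at this
  | cons y s =>
    -- The orders `b a c` and `c a b` have the same word, as do `a c b` and `b c a`; only the step
    -- to the next cell `y` may differ. For the first pair it differs exactly when the row of `y`
    -- separates `b` from `c`, and then it is a descent for both orders of the second pair.
    by_cases hy : b.1 < y.1 ∧ y.1 ≤ c.1
    · have := h _ _ k3 k4 (by
        have : a.1 < y.1 := by omega
        simp [n2, n3, p1, rbc, hy.1, this])
      simp [hab'] at this
    · have := h _ _ k1 k2 (by
        have : decide (c.1 < y.1) = decide (b.1 < y.1) := decide_eq_decide.2 (by omega)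
        simp [n1, n2, p1, rab, this])
      simp [hbc'] at this

/-- Rotation by 180 degrees inside the `h × w` rectangle. -/
def rotate (h w : ℕ) (x : ℕ × ℕ) : ℕ × ℕ := (h - 1 - x.1, w - 1 - x.2)

theorem isAntiIso_rotate {h w : ℕ} (hC : ∀ x ∈ C, x.1 < h ∧ x.2 < w)
    (hD : ∀ i < h, ∀ j < w, (i, j) ∈ C ↔ (h - 1 - i, w - 1 - j) ∈ D)
    (hD' : ∀ x ∈ D, x.1 < h ∧ x.2 < w) : IsAntiIso C D (rotate h w) := by
  refine ⟨?_, ?_, ?_, ?_⟩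
  · rintro ⟨i, j⟩ hx
    obtain ⟨h1, h2⟩ := hC _ hx
    exact (hD i h1 j h2).1 hx
  · rintro ⟨i, j⟩ hy
    obtain ⟨h1, h2⟩ := hD' _ hy
    simp only at h1 h2
    have e1 : h - 1 - (h - 1 - i) = i := by omega
    have e2 : w - 1 - (w - 1 - j) = j := by omega
    refine ⟨(h - 1 - i, w - 1 - j), ?_, Prod.ext e1 e2⟩
    rw [hD _ (by omega) _ (by omega), e1, e2]
    exact hy
  · rintro ⟨i, j⟩ hx ⟨i', j'⟩ hy
    have h1 := hC _ hx
    have h2 := hC _ hy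
    simp only [rotate, Prod.mk_le_mk] at h1 h2 ⊢
    omega
  · rintro ⟨i, j⟩ hx ⟨i', j'⟩ hy
    have h1 := hC _ hx
    have h2 := hC _ hy
    simp only [rotate] at h1 h2 ⊢
    omega

theorem exists_bound (C : Finset (ℕ × ℕ)) : ∃ N, ∀ x ∈ C, x.1 < N ∧ x.2 < N := by
  refine ⟨C.sup (fun x => x.1 + x.2) + 1, fun x hx => ?_⟩
  have : x.1 + x.2 ≤ C.sup (fun x => x.1 + x.2) :=
    Finset.le_sup (f := fun x : ℕ × ℕ => x.1 + x.2) hx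
  omega

theorem MultFree.not_three_maximal (h : MultFree C) {a b c : ℕ × ℕ}
    (ha : Maximal (· ∈ C) a) (hb : Maximal (· ∈ C) b) (hc : Maximal (· ∈ C) c)
    (hab : b.2 < a.2) (hbc : c.2 < b.2) : False := by
  obtain ⟨N, hN⟩ := exists_bound C
  have hiso : IsAntiIso C (C.image (rotate N N)) (rotate N N) := by
    refine isAntiIso_rotate hN (fun i hi j hj => ?_) ?_
    · rw [Finset.mem_image]
      constructor
      · exact fun hx => ⟨_, hx, rfl⟩
      · rintro ⟨x, hx, e⟩
        have := hN x hx
        simp only [rotate, Prod.mk.injEq] at e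
        rwa [show (i, j) = x from Prod.ext (by simp; omega) (by simp; omega)]
    · intro x hx
      obtain ⟨y, hy, rfl⟩ := Finset.mem_image.1 hx
      have := hN y hy
      simp only [rotate]
      omega
  have hmin : ∀ x, Maximal (· ∈ C) x → Minimal (· ∈ C.image (rotate N N)) (rotate N N x) := by
    intro x hx
    refine ⟨hiso.mem x hx.prop, fun y hy hyx => ?_⟩
    obtain ⟨y, hy', rfl⟩ := hiso.surj y hy
    rw [hiso.le_iff y hy' x hx.prop] at hyx
    rw [hx.eq_of_le hy' hyx]
  have h1 := hN a ha.prop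
  have h2 := hN b hb.prop
  have h3 := hN c hc.prop
  refine (hiso.multFree h).not_three_minimal (hmin c hc) (hmin b hb) (hmin a ha) ?_ ?_ <;>
  · simp only [rotate]
    omega

theorem exists_count_eq {p : ℕ → Prop} [DecidablePred p] {m N : ℕ} (h : m < Nat.count p N) :
    ∃ k < N, p k ∧ Nat.count p k = m := by
  induction N with
  | zero => simp at h
  | succ N ih =>
    rw [Nat.count_succ] at h
    by_cases hm : m < Nat.count p N
    · obtain ⟨k, hk, h1, h2⟩ := ih hm
      exact ⟨k, by omega, h1, h2⟩
    · split_ifs at h with hp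
      · exact ⟨N, by omega, hp, by omega⟩
      · omega

/-- Every shape is isomorphic to one without empty rows and columns. -/
theorem exists_isIso_normalized (hC : Convex C) : ∃ D φ h w, IsIso C D φ ∧ Convex D ∧
    (∀ x ∈ D, x.1 < h ∧ x.2 < w) ∧ (∀ i < h, ∃ j, (i, j) ∈ D) ∧ ∀ j < w, ∃ i, (i, j) ∈ D := by
  classical
  let p : ℕ → Prop := fun i => ∃ j, (i, j) ∈ C
  let q : ℕ → Prop := fun j => ∃ i, (i, j) ∈ C
  -- Each row and column is renumbered by the number of nonempty ones before it.
  let φ : ℕ × ℕ → ℕ × ℕ := fun x => (Nat.count p x.1, Nat.count q x.2)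
  have hp : ∀ x ∈ C, p x.1 := fun x hx => ⟨x.2, hx⟩
  have hq : ∀ x ∈ C, q x.2 := fun x hx => ⟨x.1, hx⟩
  have hlt : ∀ {r : ℕ → Prop} [DecidablePred r] {i j : ℕ}, r i →
      (Nat.count r i < Nat.count r j ↔ i < j) := by
    intro r _ i j hi
    refine ⟨fun h => ?_, fun h => Nat.count_strict_mono hi h⟩
    by_contra hle
    exact absurd (Nat.count_monotone r (not_lt.1 hle)) (not_le.2 h)
  have hle : ∀ {r : ℕ → Prop} [DecidablePred r] {i j : ℕ}, r j →
      (Nat.count r i ≤ Nat.count r j ↔ i ≤ j) := by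
    intro r _ i j hj
    rw [← not_lt, hlt hj, not_lt]
  obtain ⟨N, hN⟩ := exists_bound C
  refine ⟨C.image φ, φ, Nat.count p N, Nat.count q N, ⟨?_, ?_, ?_, ?_⟩, ?_, ?_, ?_, ?_⟩
  · exact fun x hx => Finset.mem_image_of_mem _ hx
  · exact fun y hy => Finset.mem_image.1 hy
  · intro x hx y hy
    simp only [φ, Prod.le_def, hle (hp y hy), hle (hq y hy)]
  · intro x hx y _
    simp only [φ, hlt (hp x hx)]
  · intro x' hx' y' hy' z hxz hzy
    obtain ⟨x, hx, rfl⟩ := Finset.mem_image.1 hx'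
    obtain ⟨y, hy, rfl⟩ := Finset.mem_image.1 hy'
    obtain ⟨i, hi, hpi, ei⟩ := exists_count_eq (p := p) (m := z.1) (N := y.1 + 1)
      (lt_of_le_of_lt hzy.1 (Nat.count_strict_mono (hp y hy) (by omega)))
    obtain ⟨j, hj, hqj, ej⟩ := exists_count_eq (p := q) (m := z.2) (N := y.2 + 1)
      (lt_of_le_of_lt hzy.2 (Nat.count_strict_mono (hq y hy) (by omega)))
    have hxi : x.1 ≤ i := (hle hpi).1 (by rw [ei]; exact hxz.1)
    have hxj : x.2 ≤ j := (hle hqj).1 (by rw [ej]; exact hxz.2)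
    exact Finset.mem_image.2 ⟨(i, j), hC x hx y hy _ ⟨hxi, hxj⟩ ⟨by simp; omega, by simp; omega⟩,
      Prod.ext ei ej⟩
  · intro x' hx'
    obtain ⟨x, hx, rfl⟩ := Finset.mem_image.1 hx'
    exact ⟨(hlt (hp x hx)).2 (hN x hx).1, (hlt (hq x hx)).2 (hN x hx).2⟩
  · intro i hi
    obtain ⟨k, -, ⟨j, hkj⟩, rfl⟩ := exists_count_eq hi
    exact ⟨_, Finset.mem_image_of_mem φ hkj⟩
  · intro j hj
    obtain ⟨k, -, ⟨i, hik⟩, rfl⟩ := exists_count_eq hj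
    exact ⟨_, Finset.mem_image_of_mem φ hik⟩

/-- The rows of a shape are intervals, moving weakly to the left. -/
theorem exists_row_bounds (hC : Convex C) {h : ℕ} (hrow : ∀ i < h, ∃ j, (i, j) ∈ C) :
    ∃ s e : ℕ → ℕ, (∀ i < h, s i < e i) ∧ (∀ i < h, ∀ j, (i, j) ∈ C ↔ s i ≤ j ∧ j < e i) ∧
      (∀ i i', i ≤ i' → i' < h → s i' ≤ s i) ∧ (∀ i i', i ≤ i' → i' < h → e i' ≤ e i) := by
  have : ∀ i, ∃ a b, i < h → a < b ∧ ∀ j, (i, j) ∈ C ↔ a ≤ j ∧ j < b := by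
    intro i
    by_cases hi : i < h
    swap
    · exact ⟨0, 0, fun h => absurd h hi⟩
    let R := (C.filter fun x => x.1 = i).image Prod.snd
    have hR : ∀ j, j ∈ R ↔ (i, j) ∈ C := by
      intro j
      simp only [R, Finset.mem_image, Finset.mem_filter, Prod.exists]
      exact ⟨fun ⟨a, b, ⟨h1, h2⟩, h3⟩ => by rw [← h2, ← h3]; exact h1,
        fun h => ⟨i, j, ⟨h, rfl⟩, rfl⟩⟩
    have hne : R.Nonempty := by
      obtain ⟨j, hj⟩ := hrow i hi
      exact ⟨j, (hR j).2 hj⟩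
    refine ⟨R.min' hne, R.max' hne + 1, fun _ => ⟨?_, fun j => ⟨fun hj => ?_, fun hj => ?_⟩⟩⟩
    · exact Nat.lt_succ_of_le (R.min'_le_max' hne)
    · have h1 := R.min'_le j ((hR j).2 hj)
      have h2 := R.le_max' j ((hR j).2 hj)
      omega
    · exact hC _ ((hR _).1 (R.min'_mem hne)) _ ((hR _).1 (R.max'_mem hne)) _
        ⟨le_rfl, hj.1⟩ ⟨le_rfl, by simp; omega⟩
  choose s e hse using this
  refine ⟨s, e, fun i hi => (hse i hi).1, fun i hi => (hse i hi).2, fun i i' hii hi' => ?_,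
    fun i i' hii hi' => ?_⟩
  · by_contra hlt
    have h1 := hse i (by omega)
    have h2 := hse i' hi'
    have := hC (i, s i) ((h1.2 _).2 (by omega)) (i', s i') ((h2.2 _).2 (by omega)) (i', s i)
      ⟨hii, le_rfl⟩ ⟨le_rfl, by simp; omega⟩
    have := (h2.2 _).1 this
    omega
  · by_contra hlt
    have h1 := hse i (by omega)
    have h2 := hse i' hi'
    have := hC (i, e i - 1) ((h1.2 _).2 (by omega)) (i', e i' - 1) ((h2.2 _).2 (by omega))
      (i, e i' - 1) ⟨le_rfl, by simp; omega⟩ ⟨hii, le_rfl⟩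
    have := (h1.2 _).1 this
    omega

end CellSet

/-! ### Classification of multiplicity-free shapes -/

namespace CellSet

variable {C D : Finset (ℕ × ℕ)}

/-- The parameters of a shape without empty rows and columns. -/
structure IsReduced (h w S u P v : ℕ) : Prop where
  S_lt : S < h
  u_lt : u < w
  S_eq_zero_iff : S = 0 ↔ u = 0
  P_pos : 0 < P
  v_pos : 0 < v
  P_le : P ≤ h
  v_le : v ≤ w
  P_eq_iff : P = h ↔ v = w
  row : P < S → u < v
  col : v < u → S < P

/-- Every row start is the column of a minimal cell, so row starts take at most two values, and the
last is 0 because column 0 is not empty. Dually, row ends take at most two values, the first being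
`w`. The shape is thus fixed by where each of them changes. -/
theorem MultFree.eq_shape (hM : MultFree D) (hD : Convex D) (hne : D.Nonempty) {h w : ℕ}
    (hbound : ∀ x ∈ D, x.1 < h ∧ x.2 < w) (hrow : ∀ i < h, ∃ j, (i, j) ∈ D)
    (hcol : ∀ j < w, ∃ i, (i, j) ∈ D) :
    ∃ S u P v, IsReduced h w S u P v ∧ D = shape h w S u P v := by
  obtain ⟨s, e, hse, hmem, hs, he⟩ := exists_row_bounds hD hrow
  obtain ⟨⟨i₀, j₀⟩, hx₀⟩ := hne
  have hpos := hbound _ hx₀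
  simp only at hpos
  -- cells at the beginnings (ends) of rows dominate minimal (are dominated by maximal) cells
  have hmin : ∀ i < h, ∃ m, Minimal (· ∈ D) m ∧ m.2 = s i := by
    intro i hi
    obtain ⟨m, hm, hmm⟩ := D.exists_le_minimal ((hmem i hi (s i)).2 ⟨le_rfl, hse i hi⟩)
    have hm1 := (hbound m hmm.prop).1
    have := (hmem m.1 hm1 m.2).1 hmm.prop
    exact ⟨m, hmm, le_antisymm hm.2 ((hs m.1 i hm.1 hi).trans this.1)⟩
  have hmax : ∀ i < h, ∃ m, Maximal (· ∈ D) m ∧ m.2 + 1 = e i := by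
    intro i hi
    have := hse i hi
    obtain ⟨m, hm, hmm⟩ := D.exists_le_maximal ((hmem i hi (e i - 1)).2 ⟨by omega, by omega⟩)
    have hm1 := (hbound m hmm.prop).1
    have h1 := (hmem m.1 hm1 m.2).1 hmm.prop
    have h2 : e i - 1 ≤ m.2 := hm.2
    have h3 := he i m.1 hm.1 hm1
    exact ⟨m, hmm, by omega⟩
  have hs3 : ∀ i j k, i < h → j < h → k < h → s j < s i → ¬ s k < s j := by
    intro i j k hi hj hk hij hjk
    obtain ⟨a, ha, ha'⟩ := hmin i hi
    obtain ⟨b, hb, hb'⟩ := hmin j hj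
    obtain ⟨c, hc, hc'⟩ := hmin k hk
    exact hM.not_three_minimal ha hb hc (by omega) (by omega)
  have he3 : ∀ i j k, i < h → j < h → k < h → e j < e i → ¬ e k < e j := by
    intro i j k hi hj hk hij hjk
    obtain ⟨a, ha, ha'⟩ := hmax i hi
    obtain ⟨b, hb, hb'⟩ := hmax j hj
    obtain ⟨c, hc, hc'⟩ := hmax k hk
    exact hM.not_three_maximal ha hb hc (by omega) (by omega)
  have hslast : s (h - 1) = 0 := by
    obtain ⟨i, hi⟩ := hcol 0 (by omega)
    have hih := (hbound _ hi).1
    simp only at hih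
    have h1 := (hmem i hih 0).1 hi
    have h2 := hs i (h - 1) (by omega) (by omega)
    omega
  have hew : ∀ i < h, e i ≤ w := by
    intro i hi
    have h0 := hse i hi
    have := (hbound _ ((hmem i hi (e i - 1)).2 (by omega))).2
    simp only at this
    omega
  have hefirst : e 0 = w := by
    obtain ⟨i, hi⟩ := hcol (w - 1) (by omega)
    have hih := (hbound _ hi).1
    simp only at hih
    have h1 := (hmem i hih _).1 hi
    have h2 := he 0 i (by omega) hih
    have h3 := hew 0 (by omega)
    omega
  obtain ⟨S, hS, hS0⟩ : ∃ S < h, ∀ i < h, i < S ↔ s i ≠ 0 := by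
    classical
    have hex : ∃ i, i < h ∧ s i = 0 := ⟨h - 1, by omega, hslast⟩
    refine ⟨Nat.find hex, (Nat.find_spec hex).1, fun i hi => ⟨fun hlt e => ?_, fun hne => ?_⟩⟩
    · exact Nat.find_min hex hlt ⟨hi, e⟩
    · by_contra hle
      have := hs _ i (not_lt.1 hle) hi
      rw [(Nat.find_spec hex).2] at this
      omega
  obtain ⟨P, hP, hPw⟩ : ∃ P ≤ h, ∀ i < h, i < P ↔ e i = w := by
    classical
    -- The value `h` is the default when all rows reach the last column.
    have hex : ∃ i, i = h ∨ i < h ∧ e i ≠ w := ⟨h, .inl rfl⟩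
    have hle : Nat.find hex ≤ h := Nat.find_min' hex (.inl rfl)
    refine ⟨Nat.find hex, hle, fun i hi => ⟨fun hlt => ?_, fun heq => ?_⟩⟩
    · by_contra hne
      exact Nat.find_min hex hlt (.inr ⟨hi, hne⟩)
    · by_contra hle
      have h1 := he _ i (not_lt.1 hle) hi
      rcases Nat.find_spec hex with h2 | ⟨h2, h3⟩
      · omega
      · have := hew _ h2
        omega
  have hsv : ∀ i < h, i < S → s i = s 0 := by
    intro i hi hiS
    have h1 := (hS0 i hi).1 hiS
    have h2 := hs 0 i (by omega) hi
    have h3 := hs3 0 i (h - 1) (by omega) hi (by omega)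
    omega
  have hev : ∀ i < h, P ≤ i → e i = e (h - 1) := by
    intro i hi hiP
    have h1 := (hPw i hi).not.1 (by omega)
    have h2 := he i (h - 1) (by omega) (by omega)
    have h3 := he3 0 i (h - 1) (by omega) hi (by omega)
    have h4 := hew i hi
    omega
  have hmemD : ∀ i j, (i, j) ∈ D ↔ (i, j) ∈ shape h w S (s 0) P (e (h - 1)) := by
    intro i j
    rw [mem_shape]
    by_cases hi : i < h
    swap
    · exact ⟨fun hx => absurd (hbound _ hx).1 hi, fun hx => absurd hx.1 hi⟩
    rw [hmem i hi]
    have h1 := hsv i hi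
    have h2 := hev i hi
    have h3 := hS0 i hi
    have h4 := hPw i hi
    have h5 := hew i hi
    have h6 := hew (h - 1) (by omega)
    omega
  have h0 := hS0 0 (by omega)
  have h1 := hse 0 (by omega)
  have h2 := hse (h - 1) (by omega)
  have h3 := hPw 0 (by omega)
  have h4 := hPw (h - 1) (by omega)
  have h5 := hew (h - 1) (by omega)
  refine ⟨S, s 0, P, e (h - 1), ⟨hS, by omega, by omega, by omega, by omega, hP, h5, by omega,
    fun hPS => ?_, fun hvu => ?_⟩, Finset.ext fun ⟨i, j⟩ => hmemD i j⟩
  · have := hse P (by omega)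
    rw [hsv P (by omega) hPS, hev P (by omega) le_rfl] at this
    exact this
  · obtain ⟨i, hi⟩ := hcol (e (h - 1)) (by omega)
    rw [hmemD, mem_shape] at hi
    omega

theorem isAntiIso_shape {h w S u P v : ℕ} (hS : S ≤ h) (hu : u ≤ w) (hP : P ≤ h) (hv : v ≤ w) :
    IsAntiIso (shape h w S u P v) (shape h w (h - P) (w - v) (h - S) (w - u)) (rotate h w) := by
  refine isAntiIso_rotate ?_ (fun i hi j hj => ?_) ?_
  · rintro ⟨i, j⟩ hx
    rw [mem_shape] at hx
    exact ⟨hx.1, hx.2.1⟩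
  · rw [mem_shape, mem_shape]
    omega
  · rintro ⟨i, j⟩ hx
    rw [mem_shape] at hx
    exact ⟨hx.1, hx.2.1⟩

theorem MultFree.rectangle {h w : ℕ} (hM : MultFree (shape h w 0 0 h w)) :
    h ≤ 1 ∨ w ≤ 1 ∨ h = 2 ∧ w ≤ 4 ∨ w = 2 ∧ h ≤ 4 := by
  by_contra hcon
  by_cases h1 : 3 ≤ h ∧ 3 ≤ w
  · exact not_multFree_shape_3_3_0_0_3_3 (hM.shape_window 0 0 fun i j _ _ => by omega)
  by_cases h2 : h = 2
  · exact not_multFree_shape_2_5_0_0_2_5 (hM.shape_window 0 0 fun i j _ _ => by omega)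
  · exact not_multFree_shape_5_2_0_0_5_2 (hM.shape_window 0 0 fun i j _ _ => by omega)

/-- The window offsets align the removed corner at `(P, v)` with that of a small obstruction. What
escapes is a hook, two rows the second of length 2, or the transpose of the latter. -/
theorem MultFree.straight {h w P v : ℕ} (hM : MultFree (shape h w 0 0 P v)) (hP : 0 < P)
    (hP' : P < h) (hv : 0 < v) (hv' : v < w) :
    P = 1 ∧ v = 1 ∨ P = 1 ∧ v = 2 ∧ h = 2 ∨ P = 2 ∧ v = 1 ∧ w = 2 := by
  by_contra hcon
  by_cases hP1 : P = 1
  · by_cases hv2 : v = 2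
    · exact not_multFree_shape_3_3_0_0_1_2 (hM.shape_window 0 0 fun i j _ _ => by omega)
    · exact not_multFree_shape_2_4_0_0_1_3 (hM.shape_window 0 (v - 3) fun i j _ _ => by omega)
  by_cases hv1 : v = 1
  · by_cases hw : w = 2
    · exact not_multFree_shape_4_2_0_0_3_1 (hM.shape_window (P - 3) 0 fun i j _ _ => by omega)
    · exact not_multFree_shape_3_3_0_0_2_1 (hM.shape_window (P - 2) 0 fun i j _ _ => by omega)
  · exact not_multFree_shape_3_3_0_0_2_2
      (hM.shape_window (P - 2) (v - 2) fun i j _ _ => by omega)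

theorem MultFree.rotated_straight {h w S u : ℕ} (hM : MultFree (shape h w S u h w)) (hS : 0 < S)
    (hS' : S < h) (hu : 0 < u) (hu' : u < w) :
    h = S + 1 ∧ w = u + 1 ∨ h = 2 ∧ S = 1 ∧ w = u + 2 ∨ h = S + 2 ∧ w = 2 ∧ u = 1 := by
  have h1 := (isAntiIso_shape hS'.le hu'.le le_rfl le_rfl).multFree hM
  rw [Nat.sub_self, Nat.sub_self] at h1
  have := h1.straight (by omega) (by omega) (by omega) (by omega)
  omega

theorem image_swap_shape (h w S u P v : ℕ) :
    (shape h w S u P v).image Prod.swap = shape w h u S v P := by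
  ext ⟨i, j⟩
  simp only [Finset.mem_image, Prod.exists, Prod.swap_prod_mk, Prod.mk.injEq]
  constructor
  · rintro ⟨a, b, hx, rfl, rfl⟩
    rw [mem_shape] at hx ⊢
    omega
  · intro hx
    refine ⟨j, i, ?_, rfl, rfl⟩
    rw [mem_shape] at hx ⊢
    omega

/-- The rows from `S` on form a straight shape and the rows before `P` a rotated one. Their
classifications leave one or two full rows between the corner blocks, that is, the staircase family
or one shape with two columns. -/
theorem not_multFree_of_wide {h w S u P v : ℕ} (hR : IsReduced h w S u P v) (hS : 0 < S)
    (hP : P < h) (hSP : S < P) (huv : v ≤ u) : ¬ MultFree (shape h w S u P v) := by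
  obtain ⟨h1, h2, h3, h4, h5, h6, h7, h8, -, -⟩ := hR
  intro hM
  have hlow : MultFree (shape (h - S) w 0 0 (P - S) v) :=
    hM.shape_window S 0 fun i j _ _ => by omega
  have hup : MultFree (shape P w S u P w) := hM.shape_window 0 0 fun i j _ _ => by omega
  have e1 := hlow.straight (by omega) (by omega) (by omega) (by omega)
  have e2 := hup.rotated_straight (by omega) (by omega) (by omega) (by omega)
  by_cases hPS : P = S + 1
  · refine not_multFree_shape_staircase (u - v) (hM.shape_window (S - 1) (v - 1) fun i j _ _ => ?_)
    omega
  · refine not_multFree_shape_4_2_1_1_3_1 (hM.shape_window (S - 1) 0 fun i j _ _ => ?_)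
    omega

theorem MultFree.disconnected {h w S u P v : ℕ} (hM : MultFree (shape h w S u P v))
    (hR : IsReduced h w S u P v) (hS : 0 < S) (hP : P < h) :
    S = 1 ∧ u = 1 ∧ P = 1 ∧ v = 1 ∨ h = S + 1 ∧ w = u + 1 ∧ P = S ∧ v = u := by
  have hR' := hR
  obtain ⟨h1, h2, h3, h4, h5, h6, h7, h8, h9, h10⟩ := hR
  by_cases hSP : S < P
  · by_cases huv : v ≤ u
    · exact absurd hM (not_multFree_of_wide hR' hS hP hSP huv)
    · have hlow : MultFree (shape (h - S) w 0 0 (P - S) v) :=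
        hM.shape_window S 0 fun i j _ _ => by omega
      have hup : MultFree (shape P w S u P w) := hM.shape_window 0 0 fun i j _ _ => by omega
      have e1 := hlow.straight (by omega) (by omega) (by omega) (by omega)
      have e2 := hup.rotated_straight (by omega) (by omega) (by omega) (by omega)
      exact absurd (hM.shape_window 0 0 fun i j _ _ => by omega) not_multFree_shape_3_3_1_1_2_2
  by_cases huv : u < v
  · have hM' := hM.image_swap (convex_shape _ _ _ _ _ _)
    rw [image_swap_shape] at hM'
    exact absurd hM' (not_multFree_of_wide
      ⟨h2, h1, h3.symm, h5, h4, h7, h6, h8.symm, by omega, by omega⟩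
      (by omega) (by omega) huv (by omega))
  -- Here `P = S` and `v = u`, since no row or column is empty: the shape consists of two rectangles
  -- touching at a corner. The four windows show that one must be a single row and the other a
  -- single column.
  by_contra hcon
  by_cases hS2 : 2 ≤ S
  · by_cases hw : u + 2 ≤ w
    · exact not_multFree_shape_3_3_2_1_2_1
        (hM.shape_window (S - 2) (u - 1) fun i j _ _ => by omega)
    · exact not_multFree_shape_4_2_2_1_2_1
        (hM.shape_window (S - 2) (u - 1) fun i j _ _ => by omega)
  · by_cases hw : u + 2 ≤ w
    · exact not_multFree_shape_2_4_1_2_1_2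
        (hM.shape_window (S - 1) (u - 2) fun i j _ _ => by omega)
    · exact not_multFree_shape_3_3_1_2_1_2
        (hM.shape_window (S - 1) (u - 2) fun i j _ _ => by omega)

/-- The cases are separated by which corner blocks are removed: `S = 0` means none at the upper
left, `P = h` none at the lower right. -/
theorem MultFree.classification {h w S u P v : ℕ} (hM : MultFree (shape h w S u P v))
    (hR : IsReduced h w S u P v) :
    (h = 1 ∨ w = 1) ∨ (S = 0 ∧ P = 1 ∧ v = 1) ∨ (P = h ∧ h = S + 1 ∧ w = u + 1) ∨
    (S = 1 ∧ u = 1 ∧ P = 1 ∧ v = 1) ∨ (h = S + 1 ∧ w = u + 1 ∧ P = S ∧ v = u) ∨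
    (h = 2 ∧ S = 0 ∧ P = 1 ∧ v = 2) ∨ (h = 2 ∧ P = h ∧ S = 1 ∧ w = u + 2) ∨
    (w = 2 ∧ S = 0 ∧ P = 2 ∧ v = 1) ∨ (w = 2 ∧ P = h ∧ h = S + 2 ∧ u = 1) ∨
    (h = 2 ∧ S = 0 ∧ P = h ∧ 2 ≤ w ∧ w ≤ 4) ∨ (w = 2 ∧ S = 0 ∧ P = h ∧ 2 ≤ h ∧ h ≤ 4) := by
  have hR' := hR
  obtain ⟨h1, h2, h3, h4, h5, h6, h7, h8, h9, h10⟩ := hR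
  rcases Nat.eq_zero_or_pos S with hS | hS
  · obtain rfl : u = 0 := by omega
    subst hS
    rcases h6.eq_or_lt with hP | hP
    · obtain rfl : v = w := by omega
      subst hP
      by_cases hP1 : P = 1
      · exact .inl (.inl hP1)
      by_cases hv1 : v = 1
      · exact .inl (.inr hv1)
      rcases hM.rectangle with h | h | ⟨h, h'⟩ | ⟨h, h'⟩
      · exact absurd h (by omega)
      · exact absurd h (by omega)
      · exact .inr (.inr (.inr (.inr (.inr (.inr (.inr (.inr (.inr (.inl ⟨h, rfl, rfl, by omega, h'⟩)))))))))
      · exact .inr (.inr (.inr (.inr (.inr (.inr (.inr (.inr (.inr (.inr (⟨h, rfl, rfl, by omega, h'⟩))))))))))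
    · rcases hM.straight h4 hP h5 (by omega) with ⟨h, h'⟩ | ⟨h, h', h''⟩ | ⟨h, h', h''⟩
      · exact .inr (.inl ⟨rfl, h, h'⟩)
      · exact .inr (.inr (.inr (.inr (.inr (.inl ⟨h'', rfl, h, h'⟩)))))
      · exact .inr (.inr (.inr (.inr (.inr (.inr (.inr (.inl ⟨h'', rfl, h, h'⟩)))))))
  · rcases h6.eq_or_lt with hP | hP
    · obtain rfl : v = w := by omega
      subst hP
      rcases hM.rotated_straight hS h1 (by omega) h2 with ⟨h, h'⟩ | ⟨h, h', h''⟩ | ⟨h, h', h''⟩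
      · exact .inr (.inr (.inl ⟨rfl, h, h'⟩))
      · exact .inr (.inr (.inr (.inr (.inr (.inr (.inl ⟨h, rfl, h', h''⟩))))))
      · exact .inr (.inr (.inr (.inr (.inr (.inr (.inr (.inr (.inl ⟨h', rfl, h, h''⟩))))))))
    · rcases hM.disconnected hR' hS hP with h | h
      · exact .inr (.inr (.inr (.inl h)))
      · exact .inr (.inr (.inr (.inr (.inl h))))

end CellSet

namespace CellSet

variable {C D X : Finset (ℕ × ℕ)} {l : List (ℕ × ℕ)}

/-! ### Words of hooks -/

theorem IsLinExt.perm {l' : List (ℕ × ℕ)} (h : IsLinExt C l) (h' : IsLinExt C l') : l.Perm l' :=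
  (List.perm_ext_iff_of_nodup h.nodup h'.nodup).2 fun x => by rw [h.mem_iff, h'.mem_iff]

/-- In a part of a hook, the descents record which cells lie below the first row. -/
theorem IsLinExt.descents_eq_map_tail (h : IsLinExt X l) (hX : ∀ x ∈ X, x.1 = 0 ∨ x.2 = 0) :
    descents l = l.tail.map fun y => decide (0 < y.1) := by
  refine descents_eq_of_forall_tail (h.pairwise.imp_of_mem fun {x y} hx hy hxy => ?_)
  have h1 := hX x ((h.mem_iff x).1 hx)
  have h2 := hX y ((h.mem_iff y).1 hy)
  rw [Prod.le_def] at hxy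
  rw [decide_eq_decide]
  omega

/-- Fill the first column from row `i` on and the first row from column `j` on, in the order
prescribed by a word. -/
def fillHook : ℕ → ℕ → List Bool → List (ℕ × ℕ)
  | _, _, [] => []
  | i, j, true :: v => (i, 0) :: fillHook (i + 1) j v
  | i, j, false :: v => (0, j) :: fillHook i (j + 1) v

theorem mem_fillHook {x : ℕ × ℕ} : ∀ {i j : ℕ} {v : List Bool}, x ∈ fillHook i j v ↔
    (x.2 = 0 ∧ i ≤ x.1 ∧ x.1 < i + v.count true) ∨ (x.1 = 0 ∧ j ≤ x.2 ∧ x.2 < j + v.count false)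
  | i, j, [] => by simp [fillHook]
  | i, j, true :: v => by
    simp only [fillHook, List.mem_cons, mem_fillHook, List.count_cons, Prod.ext_iff]
    simp only [beq_self_eq_true, if_true, Bool.true_beq, Bool.false_eq_true, if_false]
    omega
  | i, j, false :: v => by
    simp only [fillHook, List.mem_cons, mem_fillHook, List.count_cons, Prod.ext_iff]
    simp
    omega

theorem pairwise_fillHook : ∀ {i j : ℕ} {v : List Bool}, 0 < i → 0 < j →
    (fillHook i j v).Pairwise fun a b => ¬ b ≤ a
  | i, j, [], _, _ => .nil
  | i, j, true :: v, hi, hj => by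
    refine List.pairwise_cons.2 ⟨fun x hx hle => ?_, pairwise_fillHook (by omega) hj⟩
    rw [mem_fillHook] at hx
    have h1 : x.1 ≤ i := hle.1
    have h2 : x.2 ≤ 0 := hle.2
    omega
  | i, j, false :: v, hi, hj => by
    refine List.pairwise_cons.2 ⟨fun x hx hle => ?_, pairwise_fillHook hi (by omega)⟩
    rw [mem_fillHook] at hx
    have h1 : x.1 ≤ 0 := hle.1
    have h2 : x.2 ≤ j := hle.2
    omega

theorem map_fillHook : ∀ {i j : ℕ} {v : List Bool}, 0 < i →
    (fillHook i j v).map (fun y => decide (0 < y.1)) = v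
  | i, j, [], _ => rfl
  | i, j, true :: v, hi => by
    simp [fillHook, hi, map_fillHook (v := v) (i := i + 1) (j := j)]
  | i, j, false :: v, hi => by
    simp [fillHook, map_fillHook (v := v) (i := i) (j := j + 1) hi]

theorem isLinExt_fillHook (v : List Bool) : IsLinExt
    (shape (v.count true + 1) (v.count false + 1) 1 1 1 1) (fillHook 1 1 v) := by
  refine ⟨?_, pairwise_fillHook one_pos one_pos⟩
  rintro ⟨i, j⟩
  rw [mem_fillHook, mem_shape]
  omega

theorem isLinExt_cons_fillHook (v : List Bool) : IsLinExt
    (shape (v.count true + 1) (v.count false + 1) 0 0 1 1) ((0, 0) :: fillHook 1 1 v) := by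
  refine ⟨?_, List.pairwise_cons.2 ⟨fun x hx hle => ?_, pairwise_fillHook one_pos one_pos⟩⟩
  · rintro ⟨i, j⟩
    rw [List.mem_cons, mem_fillHook, mem_shape, Prod.mk.injEq]
    omega
  · rw [mem_fillHook] at hx
    have h1 : x.1 ≤ 0 := hle.1
    have h2 : x.2 ≤ 0 := hle.2
    omega

theorem shape_hook {x : ℕ × ℕ} {h w S u : ℕ} (hx : x ∈ shape h w S u 1 1) : x.1 = 0 ∨ x.2 = 0 := by
  obtain ⟨i, j⟩ := x
  rw [mem_shape] at hx
  simp only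
  omega

theorem exists_word {a b : ℕ} : ∃ v : List Bool, v.count true = a ∧ v.count false = b :=
  ⟨List.replicate a true ++ List.replicate b false, by simp [List.count_replicate],
    by simp [List.count_replicate]⟩

theorem count_true_add_count_false (v : List Bool) : v.count true + v.count false = v.length :=
  List.count_true_add_count_false v

theorem card_hook {h w : ℕ} (hh : 0 < h) (hw : 0 < w) :
    (shape h w 0 0 1 1).card = h + w - 1 := by
  obtain ⟨v, h1, h2⟩ := exists_word (a := h - 1) (b := w - 1)
  have h3 := isLinExt_cons_fillHook v
  rw [h1, h2, Nat.sub_add_cancel hh, Nat.sub_add_cancel hw] at h3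
  have h4 := congrArg List.length (map_fillHook (i := 1) (j := 1) (v := v) one_pos)
  rw [List.length_map, ← count_true_add_count_false] at h4
  rw [← h3.length_eq, List.length_cons]
  omega

theorem card_pair {h w : ℕ} (hh : 0 < h) (hw : 0 < w) :
    (shape h w 1 1 1 1).card = h + w - 2 := by
  obtain ⟨v, h1, h2⟩ := exists_word (a := h - 1) (b := w - 1)
  have h3 := isLinExt_fillHook v
  rw [h1, h2, Nat.sub_add_cancel hh, Nat.sub_add_cancel hw] at h3
  have h4 := congrArg List.length (map_fillHook (i := 1) (j := 1) (v := v) one_pos)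
  rw [List.length_map, ← count_true_add_count_false] at h4
  rw [← h3.length_eq]
  omega

/-- The corner cell comes first. After it, each letter says whether the column or the row is
continued, so only the number of column cells constrains the word. -/
theorem words_hook {h w : ℕ} (hh : 0 < h) (hw : 0 < w) :
    words (shape h w 0 0 1 1) = {v | v.length = h + w - 2 ∧ v.count true = h - 1} := by
  ext v
  constructor
  · rintro ⟨l, hl, rfl⟩
    refine ⟨by rw [length_descents, hl.length_eq, card_hook hh hw]; omega, ?_⟩
    rw [hl.descents_eq_map_tail fun x => shape_hook]
    obtain ⟨v, h1, h2⟩ := exists_word (a := h - 1) (b := w - 1)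
    have h3 := isLinExt_cons_fillHook v
    rw [h1, h2, Nat.sub_add_cancel hh, Nat.sub_add_cancel hw] at h3
    have hp := ((hl.perm h3).map fun y : ℕ × ℕ => decide (0 < y.1)).count_eq true
    rw [List.map_cons, map_fillHook one_pos] at hp
    cases l with
    | nil => simpa using h3.perm hl
    | cons x l =>
      obtain rfl : (0, 0) = x := hl.head_minimal.2 _ (mem_shape.2 (by omega))
        ⟨Nat.zero_le _, Nat.zero_le _⟩
      simpa [h1] using hp
  · rintro ⟨h1, h2⟩
    have h3 := count_true_add_count_false v
    have h4 := isLinExt_cons_fillHook v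
    rw [show v.count true + 1 = h by omega, show v.count false + 1 = w by omega] at h4
    refine ⟨_, h4, ?_⟩
    rw [h4.descents_eq_map_tail fun x => shape_hook, List.tail_cons, map_fillHook one_pos]

/-- As for hooks, but the first cell may belong to the row or to the column and leaves no letter, so
one column cell may go uncounted. -/
theorem words_pair {h w : ℕ} (hh : 2 ≤ h) (hw : 2 ≤ w) :
    words (shape h w 1 1 1 1) =
      {v | v.length = h + w - 3 ∧ (v.count true = h - 1 ∨ v.count true = h - 2)} := by
  ext v
  constructor
  · rintro ⟨l, hl, rfl⟩
    refine ⟨by rw [length_descents, hl.length_eq, card_pair (by omega) (by omega)]; omega, ?_⟩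
    rw [hl.descents_eq_map_tail fun x => shape_hook]
    obtain ⟨v, h1, h2⟩ := exists_word (a := h - 1) (b := w - 1)
    have h3 := isLinExt_fillHook v
    rw [h1, h2, Nat.sub_add_cancel (by omega), Nat.sub_add_cancel (by omega)] at h3
    have hp := ((hl.perm h3).map fun y : ℕ × ℕ => decide (0 < y.1)).count_eq true
    rw [map_fillHook one_pos, h1] at hp
    cases l with
    | nil => simp at hp; omega
    | cons x l =>
      rw [List.map_cons, List.count_cons] at hp
      rw [List.tail_cons]
      split_ifs at hp <;> omega
  · rintro ⟨h1, h2⟩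
    -- The letter `b` restores the type of the first cell.
    obtain ⟨b, hb⟩ : ∃ b : Bool, (b :: v).count true = h - 1 := by
      rcases h2 with h2 | h2
      · exact ⟨false, by simpa using h2⟩
      · exact ⟨true, by simp; omega⟩
    have h3 := count_true_add_count_false (b :: v)
    have h4 := isLinExt_fillHook (b :: v)
    rw [List.length_cons] at h3
    rw [show (b :: v).count true + 1 = h by omega,
      show (b :: v).count false + 1 = w by omega] at h4
    refine ⟨_, h4, ?_⟩
    rw [h4.descents_eq_map_tail fun x => shape_hook, List.map_tail, map_fillHook one_pos,
      List.tail_cons]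

/-- Counting a set of cells row by row. -/
theorem card_eq_sum_of_rows {F : Finset (ℕ × ℕ)} (h : ℕ) (a n : ℕ → ℕ)
    (hF : ∀ i j, (i, j) ∈ F ↔ i < h ∧ a i ≤ j ∧ j < a i + n i) :
    F.card = ∑ i ∈ Finset.range h, n i := by
  rw [Finset.card_eq_sum_card_fiberwise (f := Prod.fst) (t := Finset.range h)]
  · refine Finset.sum_congr rfl fun i hi => ?_
    rw [Finset.mem_range] at hi
    have : n i = (Finset.Ico (a i) (a i + n i)).card := by simp
    rw [this, ← Finset.card_map (⟨fun j => (i, j), Prod.mk_right_injective i⟩ : ℕ ↪ ℕ × ℕ)]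
    congr 1
    ext ⟨i', j⟩
    simp only [Finset.mem_filter, Finset.mem_map, Finset.mem_Ico, Function.Embedding.coeFn_mk,
      Prod.mk.injEq, hF]
    constructor
    · rintro ⟨⟨_, h⟩, rfl⟩
      exact ⟨j, h, rfl, rfl⟩
    · rintro ⟨j, h, rfl, rfl⟩
      exact ⟨⟨hi, h⟩, rfl⟩
  · rintro ⟨i, j⟩ hx
    exact Finset.mem_coe.2 (Finset.mem_range.2 ((hF i j).1 hx).1)

theorem card_two_row {w : ℕ} (hw : 2 ≤ w) : (shape 2 w 0 0 1 2).card = w + 2 := by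
  rw [card_eq_sum_of_rows 2 (fun _ => 0) (fun i => if i = 0 then w else 2)]
  · simp [Finset.sum_range_succ]
  · intro i j
    rw [mem_shape]
    split_ifs <;> omega

/-! ### Words of the shape with rows of lengths `w` and `2` -/

/-- The descent word of a sequence of `p` cells of the first row, a cell of the second row, `m`
cells of the first row, a cell of the second row, and `q` cells of the first row. -/
def twoRowWord (p m q : ℕ) : List Bool :=
  List.replicate (p - 1) false ++ true :: (if m = 0 then List.replicate (q + 1) false
    else List.replicate m false ++ true :: List.replicate q false)

theorem descents_first_row {p : List (ℕ × ℕ)} (hp : ∀ x ∈ p, x.1 = 0) :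
    descents p = List.replicate (p.length - 1) false :=
  descents_eq_replicate (List.pairwise_of_forall_mem_list fun x _ y hy => by simp [hp y hy])

theorem descents_cons_first_row {p : List (ℕ × ℕ)} (hp : ∀ x ∈ p, x.1 = 0) (y : ℕ × ℕ) :
    descents (y :: p) = List.replicate p.length false := by
  refine (descents_eq_replicate (β := false) (l := y :: p) ?_).trans (by simp)
  refine List.pairwise_cons.2 ⟨fun x hx => by simp [hp x hx],
    List.pairwise_of_forall_mem_list fun x _ y hy => by simp [hp y hy]⟩

theorem descents_append_second_row {p r : List (ℕ × ℕ)} {y : ℕ × ℕ} {x : ℕ × ℕ} (hx : x.1 = 0)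
    (hy : y.1 = 1) : descents (p ++ x :: y :: r) = descents (p ++ [x]) ++ true :: descents (y :: r) := by
  rw [descents_append, hx, hy]
  rfl

theorem descents_two_row {p m q : List (ℕ × ℕ)} (hp : ∀ x ∈ p, x.1 = 0) (hm : ∀ x ∈ m, x.1 = 0)
    (hq : ∀ x ∈ q, x.1 = 0) (hp0 : p ≠ []) :
    descents (p ++ (1, 0) :: (m ++ (1, 1) :: q)) = twoRowWord p.length m.length q.length := by
  have hfirst : descents (p ++ (1, 0) :: (m ++ (1, 1) :: q)) =
      List.replicate (p.length - 1) false ++ true :: descents ((1, 0) :: (m ++ (1, 1) :: q)) := by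
    obtain rfl | ⟨p, x, rfl⟩ := List.eq_nil_or_concat p
    · exact absurd rfl hp0
    rw [← descents_first_row hp]
    simp only [List.concat_eq_append, List.append_assoc, List.cons_append, List.nil_append]
    exact descents_append_second_row (hp x (by simp)) rfl
  rw [hfirst, twoRowWord]
  congr 2
  obtain rfl | ⟨m, x, rfl⟩ := List.eq_nil_or_concat m
  · simp [descents_cons_first_row hq, List.replicate_succ]
  · have h1 := descents_cons_first_row hm (1, 0)
    simp only [List.concat_eq_append, List.append_assoc, List.cons_append, List.nil_append] at h1 ⊢
    rw [← List.cons_append, descents_append_second_row (hm x (by simp)) rfl, List.cons_append, h1,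
      descents_cons_first_row hq]
    simp

/-- Part of the first row, from column `s` on. -/
def rowSegment (s n : ℕ) : List (ℕ × ℕ) := (List.range' s n).map fun j => (0, j)

theorem mem_rowSegment {s n i j : ℕ} : (i, j) ∈ rowSegment s n ↔ i = 0 ∧ s ≤ j ∧ j < s + n := by
  simp only [rowSegment, List.mem_map, List.mem_range'_1, Prod.mk.injEq]
  exact ⟨fun ⟨a, h1, h2, h3⟩ => ⟨h2.symm, h3 ▸ h1⟩, fun ⟨h1, h2⟩ => ⟨j, h2, h1.symm, rfl⟩⟩

theorem pairwise_rowSegment (s n : ℕ) : (rowSegment s n).Pairwise fun a b => ¬ b ≤ a := by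
  rw [rowSegment, List.pairwise_map]
  exact (List.pairwise_lt_range' (s := s) (n := n)).imp fun h hle => by have := hle.2; simp at this; omega

/-- A linear extension is given by the positions of the two cells of the second row. The
inequalities say that one, respectively two, cells of the first row must precede them. -/
theorem words_two_row {w : ℕ} (hw : 2 ≤ w) : words (shape 2 w 0 0 1 2) =
    {v | ∃ p m q, 1 ≤ p ∧ 2 ≤ p + m ∧ p + m + q = w ∧ v = twoRowWord p m q} := by
  ext v
  constructor
  · rintro ⟨l, hl, rfl⟩
    obtain ⟨p, r, rfl⟩ := List.append_of_mem ((hl.mem_iff (1, 0)).2 (mem_shape.2 (by omega)))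
    have hpw := List.pairwise_append.1 hl.pairwise
    have h11 : (1, 1) ∈ r := by
      have h := (hl.mem_iff (1, 1)).2 (mem_shape.2 (by omega))
      simp only [List.mem_append, List.mem_cons] at h
      rcases h with h | h | h
      · exact absurd (by simp) (hpw.2.2 _ h (1, 0) (by simp))
      · simp at h
      · exact h
    obtain ⟨m, q, rfl⟩ := List.append_of_mem h11
    have hnd := hl.nodup
    rw [List.nodup_append] at hnd
    have hrow : ∀ x, x ∈ p ∨ x ∈ m ∨ x ∈ q → x.1 = 0 := by
      rintro ⟨i, j⟩ hx
      have hmem := (hl.mem_iff (i, j)).1 (by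
        simp only [List.mem_append, List.mem_cons]; tauto)
      rw [mem_shape] at hmem
      by_contra hi
      have hj : (i, j) = (1, 0) ∨ (i, j) = (1, 1) := by
        simp only [Prod.mk.injEq] at hi ⊢
        omega
      have hnd2 := hnd.2.1
      rw [List.nodup_cons, List.nodup_append, List.nodup_cons] at hnd2
      rcases hx with hx | hx | hx
      · exact hnd.2.2 _ hx (i, j) (by rcases hj with h | h <;> simp [h]) rfl
      · rcases hj with h | h <;> rw [h] at hx
        · exact hnd2.1 (by simp [hx])
        · exact hnd2.2.2.2 _ hx (1, 1) (by simp) rfl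
      · rcases hj with h | h <;> rw [h] at hx
        · exact hnd2.1 (by simp [hx])
        · exact hnd2.2.2.1.1 hx
    have hbefore : ∀ j < 2, (0, j) ∈ p ∨ (0, j) ∈ m := by
      intro j hj
      have h := (hl.mem_iff (0, j)).2 (mem_shape.2 (by omega))
      simp only [List.mem_append, List.mem_cons, Prod.mk.injEq] at h
      rcases h with h | h | h | h | h
      · exact .inl h
      · omega
      · exact .inr h
      · omega
      · have h3 := (List.pairwise_cons.1 (List.pairwise_append.1
          (List.pairwise_cons.1 hpw.2.1).2).2.1).1 _ h
        exact absurd ⟨by simp, by simp; omega⟩ h3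
    have h00 : (0, 0) ∈ p := by
      have h := (hl.mem_iff (0, 0)).2 (mem_shape.2 (by omega))
      rw [List.mem_append, List.mem_cons] at h
      rcases h with h | h | h
      · exact h
      · simp at h
      · exact absurd (by simp) ((List.pairwise_cons.1 hpw.2.1).1 _ h)
    have hp0 : p ≠ [] := List.ne_nil_of_mem h00
    refine ⟨p.length, m.length, q.length, List.length_pos_iff.2 hp0, ?_, ?_,
      descents_two_row (fun x hx => hrow x (.inl hx)) (fun x hx => hrow x (.inr (.inl hx)))
        (fun x hx => hrow x (.inr (.inr hx))) hp0⟩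
    · have hsub : ({(0, 0), (0, 1)} : Finset (ℕ × ℕ)) ⊆ (p ++ m).toFinset := by
        intro x hx
        simp only [Finset.mem_insert, Finset.mem_singleton] at hx
        rw [List.mem_toFinset, List.mem_append]
        rcases hx with rfl | rfl
        · exact hbefore 0 (by omega)
        · exact hbefore 1 (by omega)
      have h2 := Finset.card_le_card hsub
      have h3 := List.toFinset_card_le (p ++ m)
      rw [List.length_append] at h3
      rw [Finset.card_pair (by simp)] at h2
      omega
    · have h1 := hl.length_eq
      rw [card_two_row hw] at h1
      simp only [List.length_append, List.length_cons] at h1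
      omega
  · rintro ⟨p, m, q, h1, h2, h3, rfl⟩
    refine ⟨rowSegment 0 p ++ (1, 0) :: (rowSegment p m ++ (1, 1) :: rowSegment (p + m) q),
      ⟨?_, ?_⟩, ?_⟩
    · rintro ⟨i, j⟩
      simp only [List.mem_append, List.mem_cons, mem_rowSegment, mem_shape, Prod.mk.injEq]
      omega
    · simp only [List.pairwise_append, List.pairwise_cons, pairwise_rowSegment, List.mem_cons,
        List.mem_append, true_and, Prod.forall, mem_rowSegment, Prod.mk_le_mk, Prod.mk.injEq]
      refine ⟨⟨?_, ⟨?_, trivial⟩, ?_⟩, ?_⟩ <;> intros <;> omega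
    · rw [descents_two_row]
      · simp [rowSegment]
      · rintro ⟨i, j⟩ hx
        exact (mem_rowSegment.1 hx).1
      · rintro ⟨i, j⟩ hx
        exact (mem_rowSegment.1 hx).1
      · rintro ⟨i, j⟩ hx
        exact (mem_rowSegment.1 hx).1
      · rw [← List.length_pos_iff]
        simp only [rowSegment, List.length_map, List.length_range']
        omega

/-- Closure under reversal is what identifies the words of the shape with those of its rotation. The
new parameters are read off from the lengths of the outer runs of non-descents, which depend on
whether the two cells of the second row are consecutive (`m = 0`). -/
theorem reverse_twoRowWord {p m q : ℕ} (hp : 1 ≤ p) (hpm : 2 ≤ p + m) :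
    ∃ p' q', 1 ≤ p' ∧ 2 ≤ p' + m ∧ p' + m + q' = p + m + q ∧
      (twoRowWord p m q).reverse = twoRowWord p' m q' := by
  by_cases hm : m = 0
  · subst hm
    refine ⟨q + 2, p - 2, by omega, by omega, by omega, ?_⟩
    simp only [twoRowWord, if_true, List.reverse_append, List.reverse_cons, List.reverse_replicate,
      List.append_assoc, List.cons_append, List.nil_append]
    congr 3
    omega
  · refine ⟨q + 1, p - 1, by omega, by omega, by omega, ?_⟩
    simp [twoRowWord, hm]

theorem count_twoRowWord (p m q : ℕ) :
    (twoRowWord p m q).count true = 1 ∨ (twoRowWord p m q).count true = 2 := by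
  unfold twoRowWord
  split_ifs <;> simp [List.count_replicate]

end CellSet

namespace CellSet

variable {C D : Finset (ℕ × ℕ)}

/-! ### Comparison of multiplicity-free shapes -/

theorem card_shape_swap (h w S u P v : ℕ) :
    (shape w h u S v P).card = (shape h w S u P v).card := by
  rw [← image_swap_shape, Finset.card_image_of_injective _ Prod.swap_injective]

theorem rects_shape_swap (k l h w S u P v : ℕ) :
    rects k l (shape w h u S v P) = rects l k (shape h w S u P v) := by
  rw [← image_swap_shape, rects_image_swap]

theorem mem_rects_one_filter {h w S u P v l i j : ℕ} :
    (i, j) ∈ ((shape h w S u P v).filter fun x =>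
      ∀ a < 1, ∀ b < l + 1, (x.1 + a, x.2 + b) ∈ shape h w S u P v) ↔
      i < h ∧ j + l < w ∧ (i < S → u ≤ j) ∧ (P ≤ i → j + l < v) := by
  simp only [Finset.mem_filter, mem_shape]
  constructor
  · rintro ⟨h1, h2⟩
    have := h2 0 (by omega) l (by omega)
    omega
  · intro h1
    refine ⟨by omega, fun a ha b hb => ?_⟩
    omega

theorem rects_one_hook {h w : ℕ} (l : ℕ) (hh : 1 ≤ h) :
    rects 1 (l + 2) (shape h w 0 0 1 1) = w - (l + 1) := by
  rw [rects, card_eq_sum_of_rows 1 (fun _ => 0) (fun _ => w - (l + 1))]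
  · simp
  · intro i j
    rw [mem_rects_one_filter]
    omega

theorem rects_one_pair {h w : ℕ} (l : ℕ) (hh : 1 ≤ h) :
    rects 1 (l + 2) (shape h w 1 1 1 1) = w - 1 - (l + 1) := by
  rw [rects, card_eq_sum_of_rows 1 (fun _ => 1) (fun _ => w - 1 - (l + 1))]
  · simp
  · intro i j
    rw [mem_rects_one_filter]
    omega

theorem rects_one_two_row {w : ℕ} (l : ℕ) :
    rects 1 (l + 2) (shape 2 w 0 0 1 2) = (w - (l + 1)) + (min 2 w - (l + 1)) := by
  rw [rects, card_eq_sum_of_rows 2 (fun _ => 0)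
    (fun i => if i = 0 then w - (l + 1) else min 2 w - (l + 1))]
  · simp [Finset.sum_range_succ]
  · intro i j
    rw [mem_rects_one_filter]
    split_ifs <;> omega

theorem rects_two_row_one {w : ℕ} (k : ℕ) (hw : 2 ≤ w) :
    rects (k + 2) 1 (shape 2 w 0 0 1 2) = if k = 0 then 2 else 0 := by
  rw [← rects_shape_swap, rects,
    card_eq_sum_of_rows 2 (fun _ => 0) (fun _ => if k = 0 then 1 else 0)]
  · simp
  · intro i j
    rw [mem_rects_one_filter]
    split_ifs <;> omega

/-- Representatives of the multiplicity-free shapes, up to equality of descent words. -/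
inductive Canonical : Finset (ℕ × ℕ) → Prop
  | hook {h w : ℕ} (hh : 1 ≤ h) (hw : 1 ≤ w) : Canonical (shape h w 0 0 1 1)
  | pair {h w : ℕ} (hh : 2 ≤ h) (hw : 2 ≤ w) : Canonical (shape h w 1 1 1 1)
  | two_row {w : ℕ} (hw : 2 ≤ w) : Canonical (shape 2 w 0 0 1 2)
  | two_column {w : ℕ} (hw : 2 ≤ w) : Canonical (shape w 2 0 0 2 1)
  | rect_two_three : Canonical (shape 2 3 0 0 2 3)
  | rect_two_four : Canonical (shape 2 4 0 0 2 4)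
  | rect_three_two : Canonical (shape 3 2 0 0 3 2)
  | rect_four_two : Canonical (shape 4 2 0 0 4 2)

/-- The size of a shape and some of its rectangle counts. -/
structure Profile (D : Finset (ℕ × ℕ)) (n a₂ a₃ a₄ b₂ b₃ b₄ : ℕ) : Prop where
  card : D.card = n
  a₂ : rects 1 2 D = a₂
  a₃ : rects 1 3 D = a₃
  a₄ : rects 1 4 D = a₄
  b₂ : rects 2 1 D = b₂
  b₃ : rects 3 1 D = b₃
  b₄ : rects 4 1 D = b₄

theorem Profile.swap {n a₂ a₃ a₄ b₂ b₃ b₄ h w S u P v : ℕ}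
    (hp : Profile (shape h w S u P v) n a₂ a₃ a₄ b₂ b₃ b₄) :
    Profile (shape w h u S v P) n b₂ b₃ b₄ a₂ a₃ a₄ := by
  obtain ⟨h1, h2, h3, h4, h5, h6, h7⟩ := hp
  constructor
  · rw [card_shape_swap, h1]
  all_goals rw [rects_shape_swap]; assumption

theorem profile_hook {h w : ℕ} (hh : 1 ≤ h) (hw : 1 ≤ w) :
    Profile (shape h w 0 0 1 1) (h + w - 1) (w - 1) (w - 2) (w - 3) (h - 1) (h - 2) (h - 3) := by
  constructor
  · exact card_hook hh hw
  any_goals exact rects_one_hook _ hh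
  all_goals rw [rects_shape_swap]; exact rects_one_hook _ hw

theorem profile_pair {h w : ℕ} (hh : 2 ≤ h) (hw : 2 ≤ w) :
    Profile (shape h w 1 1 1 1) (h + w - 2) (w - 1 - 1) (w - 1 - 2) (w - 1 - 3)
      (h - 1 - 1) (h - 1 - 2) (h - 1 - 3) := by
  constructor
  · exact card_pair (by omega) (by omega)
  any_goals exact rects_one_pair _ (by omega)
  all_goals rw [rects_shape_swap]; exact rects_one_pair _ (by omega)

theorem profile_two_row {w : ℕ} (hw : 2 ≤ w) :
    Profile (shape 2 w 0 0 1 2) (w + 2) w (w - 2) (w - 3) 2 0 0 := by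
  constructor
  · exact card_two_row hw
  · rw [rects_one_two_row 0]; omega
  · rw [rects_one_two_row 1]; omega
  · rw [rects_one_two_row 2]; omega
  · exact rects_two_row_one 0 hw
  · exact rects_two_row_one 1 hw
  · exact rects_two_row_one 2 hw

theorem profile_rect_two_three : Profile (shape 2 3 0 0 2 3) 6 4 2 0 3 0 0 := by
  constructor <;> decide

theorem profile_rect_two_four : Profile (shape 2 4 0 0 2 4) 8 6 4 2 4 0 0 := by
  constructor <;> decide

theorem Canonical.cases_profile (hD : Canonical D) :
    (∃ h w, 1 ≤ h ∧ 1 ≤ w ∧ D = shape h w 0 0 1 1 ∧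
      Profile D (h + w - 1) (w - 1) (w - 2) (w - 3) (h - 1) (h - 2) (h - 3)) ∨
    (∃ h w, 2 ≤ h ∧ 2 ≤ w ∧ D = shape h w 1 1 1 1 ∧
      Profile D (h + w - 2) (w - 1 - 1) (w - 1 - 2) (w - 1 - 3) (h - 1 - 1) (h - 1 - 2)
        (h - 1 - 3)) ∨
    (∃ w, 2 ≤ w ∧ D = shape 2 w 0 0 1 2 ∧ Profile D (w + 2) w (w - 2) (w - 3) 2 0 0) ∨
    (∃ w, 2 ≤ w ∧ D = shape w 2 0 0 2 1 ∧ Profile D (w + 2) 2 0 0 w (w - 2) (w - 3)) ∨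
    (D = shape 2 3 0 0 2 3 ∧ Profile D 6 4 2 0 3 0 0) ∨
    (D = shape 2 4 0 0 2 4 ∧ Profile D 8 6 4 2 4 0 0) ∨
    (D = shape 3 2 0 0 3 2 ∧ Profile D 6 3 0 0 4 2 0) ∨
    (D = shape 4 2 0 0 4 2 ∧ Profile D 8 4 0 0 6 4 2) := by
  cases hD with
  | hook hh hw => exact .inl ⟨_, _, hh, hw, rfl, profile_hook hh hw⟩
  | pair hh hw => exact .inr (.inl ⟨_, _, hh, hw, rfl, profile_pair hh hw⟩)
  | two_row hw => exact .inr (.inr (.inl ⟨_, hw, rfl, profile_two_row hw⟩))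
  | two_column hw => exact .inr (.inr (.inr (.inl ⟨_, hw, rfl, (profile_two_row hw).swap⟩)))
  | rect_two_three => exact .inr (.inr (.inr (.inr (.inl ⟨rfl, profile_rect_two_three⟩))))
  | rect_two_four => exact .inr (.inr (.inr (.inr (.inr (.inl ⟨rfl, profile_rect_two_four⟩)))))
  | rect_three_two =>
    exact .inr (.inr (.inr (.inr (.inr (.inr (.inl ⟨rfl, profile_rect_two_three.swap⟩))))))
  | rect_four_two =>
    exact .inr (.inr (.inr (.inr (.inr (.inr (.inr ⟨rfl, profile_rect_two_four.swap⟩))))))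

theorem words_two_row_subset {w : ℕ} (hw : 2 ≤ w) :
    words (shape 2 w 0 0 1 2) ⊆ {v | v.length = w + 1 ∧ (v.count true = 1 ∨ v.count true = 2)} := by
  intro v hv
  refine ⟨?_, ?_⟩
  · obtain ⟨l, hl, rfl⟩ := hv
    rw [length_descents, hl.length_eq, card_two_row hw]
    omega
  · rw [words_two_row hw] at hv
    obtain ⟨p, m, q, -, -, -, rfl⟩ := hv
    exact count_twoRowWord p m q

theorem words_two_column (w : ℕ) :
    words (shape w 2 0 0 2 1) = List.map not '' words (shape 2 w 0 0 1 2) := by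
  rw [← image_swap_shape, words_image_swap (convex_shape _ _ _ _ _ _)]

theorem count_true_map_not (v : List Bool) : (v.map not).count true + v.count true = v.length := by
  induction v with
  | nil => rfl
  | cons b v ih =>
    cases b <;> simp <;> omega

theorem words_two_row_subset_pair {w : ℕ} (hw : 2 ≤ w) :
    words (shape 2 w 0 0 1 2) ⊆ words (shape 3 (w + 1) 1 1 1 1) := by
  rw [words_pair (by omega) (by omega)]
  intro v hv
  obtain ⟨h1, h2⟩ := words_two_row_subset hw hv
  simp only [Set.mem_ofPred_eq]
  omega

theorem words_two_column_subset_pair {w : ℕ} (hw : 2 ≤ w) :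
    words (shape w 2 0 0 2 1) ⊆ words (shape (w + 1) 3 1 1 1 1) := by
  rw [words_pair (by omega) (by omega), words_two_column]
  rintro _ ⟨v, hv, rfl⟩
  obtain ⟨h1, h2⟩ := words_two_row_subset hw hv
  have := count_true_map_not v
  simp only [Set.mem_ofPred_eq, List.length_map]
  omega

/-- Size and the counts of `1 × l` and `k × 1` rectangles with sides 2, 3, 4 decide all pairs of
types by linear arithmetic. In the surviving pairs the shapes coincide, or `A` is a row next to a
column, whose words are all those of the right length with one of two descent numbers. -/
theorem Canonical.words_subset {A B : Finset (ℕ × ℕ)} (hA : Canonical A) (hB : Canonical B)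
    (hcard : A.card = B.card)
    (hr : ∀ k l, rects (k + 1) (l + 1) A ≤ rects (k + 1) (l + 1) B) : words B ⊆ words A := by
  have p2 := hr 0 1
  have p3 := hr 0 2
  have p4 := hr 0 3
  have q2 := hr 1 0
  have q3 := hr 2 0
  have q4 := hr 3 0
  norm_num only at p2 p3 p4 q2 q3 q4
  rcases hA.cases_profile with ⟨h, w, hh, hw, eA, PA⟩ | ⟨h, w, hh, hw, eA, PA⟩ | ⟨w, hw, eA, PA⟩ |
    ⟨w, hw, eA, PA⟩ | ⟨eA, PA⟩ | ⟨eA, PA⟩ | ⟨eA, PA⟩ | ⟨eA, PA⟩ <;>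
  rcases hB.cases_profile with ⟨h', w', hh', hw', eB, PB⟩ | ⟨h', w', hh', hw', eB, PB⟩ |
    ⟨w', hw', eB, PB⟩ | ⟨w', hw', eB, PB⟩ | ⟨eB, PB⟩ | ⟨eB, PB⟩ | ⟨eB, PB⟩ | ⟨eB, PB⟩ <;>
  rw [PA.card, PB.card] at hcard <;>
  rw [PA.a₂, PB.a₂] at p2 <;> rw [PA.a₃, PB.a₃] at p3 <;> rw [PA.a₄, PB.a₄] at p4 <;>
  rw [PA.b₂, PB.b₂] at q2 <;> rw [PA.b₃, PB.b₃] at q3 <;> rw [PA.b₄, PB.b₄] at q4 <;>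
  clear PA PB <;> first | omega | subst eA eB
  · obtain rfl : h = h' := by omega
    obtain rfl : w = w' := by omega
    exact subset_rfl
  · rw [words_hook hh' hw', words_pair hh hw]
    intro v hv
    simp only [Set.mem_ofPred_eq] at hv ⊢
    omega
  · obtain rfl : h = h' := by omega
    obtain rfl : w = w' := by omega
    exact subset_rfl
  · obtain rfl : h = 3 := by omega
    obtain rfl : w = w' + 1 := by omega
    exact words_two_row_subset_pair hw'
  · obtain rfl : w = 3 := by omega
    obtain rfl : h = w' + 1 := by omega
    exact words_two_column_subset_pair hw'
  · obtain rfl : w = w' := by omega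
    exact subset_rfl
  -- The `2 × 2` square is both a two-row and a two-column representative.
  · obtain rfl : w = 2 := by omega
    obtain rfl : w' = 2 := by omega
    rw [show shape 2 2 0 0 2 1 = shape 2 2 0 0 1 2 by decide]
  · obtain rfl : w = 2 := by omega
    obtain rfl : w' = 2 := by omega
    rw [show shape 2 2 0 0 2 1 = shape 2 2 0 0 1 2 by decide]
  · obtain rfl : w = w' := by omega
    exact subset_rfl
  all_goals exact subset_rfl

/-! ### Rotation and reduction to representatives -/

theorem image_reverse_eq_self {W : Set (List Bool)} (h : ∀ v ∈ W, v.reverse ∈ W) :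
    List.reverse '' W = W := by
  ext v
  constructor
  · rintro ⟨v, hv, rfl⟩
    exact h v hv
  · exact fun hv => ⟨_, h v hv, List.reverse_reverse v⟩

theorem reverse_mem_words_two_row {w : ℕ} (hw : 2 ≤ w) :
    ∀ v ∈ words (shape 2 w 0 0 1 2), v.reverse ∈ words (shape 2 w 0 0 1 2) := by
  rw [words_two_row hw]
  rintro _ ⟨p, m, q, h1, h2, h3, rfl⟩
  obtain ⟨p', q', h4, h5, h6, h7⟩ := reverse_twoRowWord (q := q) h1 h2
  exact ⟨p', m, q', h4, h5, by omega, h7⟩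

theorem reverse_mem_words_hook {h w : ℕ} (hh : 1 ≤ h) (hw : 1 ≤ w) :
    ∀ v ∈ words (shape h w 0 0 1 1), v.reverse ∈ words (shape h w 0 0 1 1) := by
  rw [words_hook hh hw]
  intro v hv
  simpa using hv

theorem reverse_mem_words_pair {h w : ℕ} (hh : 2 ≤ h) (hw : 2 ≤ w) :
    ∀ v ∈ words (shape h w 1 1 1 1), v.reverse ∈ words (shape h w 1 1 1 1) := by
  rw [words_pair hh hw]
  intro v hv
  simpa using hv

theorem reverse_mem_words_two_column {w : ℕ} (hw : 2 ≤ w) :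
    ∀ v ∈ words (shape w 2 0 0 2 1), v.reverse ∈ words (shape w 2 0 0 2 1) := by
  rw [words_two_column]
  rintro _ ⟨v, hv, rfl⟩
  exact ⟨_, reverse_mem_words_two_row hw v hv, List.map_reverse⟩

theorem IsAntiIso.card_eq {φ : ℕ × ℕ → ℕ × ℕ} (h : IsAntiIso C D φ) : C.card = D.card :=
  Finset.card_bij (fun x _ => φ x) h.mem (fun x hx y hy e => h.inj x hx y hy e)
    (fun y hy => by obtain ⟨x, hx, e⟩ := h.surj y hy; exact ⟨x, hx, e⟩)

theorem IsAntiIso.words_eq_of_reverse_mem {φ : ℕ × ℕ → ℕ × ℕ} (h : IsAntiIso C D φ)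
    (hD : ∀ v ∈ words D, v.reverse ∈ words D) : words C = words D := by
  have h1 := image_reverse_eq_self hD
  rw [h.words_eq, Set.image_image] at h1
  simp only [List.reverse_reverse, Set.image_id'] at h1
  rw [h1, h.words_eq]

theorem shape_congr {h w S u P v S' u' P' v' : ℕ} (H : ∀ i j, i < h → j < w →
    ((i < S → u ≤ j) ∧ (P ≤ i → j < v) ↔ (i < S' → u' ≤ j) ∧ (P' ≤ i → j < v'))) :
    shape h w S u P v = shape h w S' u' P' v' := by
  ext ⟨i, j⟩
  rw [mem_shape, mem_shape]
  constructor
  · rintro ⟨h1, h2, h3⟩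
    exact ⟨h1, h2, (H i j h1 h2).1 h3⟩
  · rintro ⟨h1, h2, h3⟩
    exact ⟨h1, h2, (H i j h1 h2).2 h3⟩

/-- A classified shape is a representative itself, or its rotation is one whose word set is closed
under reversal; the rectangles with both sides at least 2 need no rotation. -/
theorem MultFree.exists_canonical_of_shape {h w S u P v : ℕ} (hM : MultFree (shape h w S u P v))
    (hR : IsReduced h w S u P v) : ∃ D, Canonical D ∧ words (shape h w S u P v) = words D ∧
      (shape h w S u P v).card = D.card := by
  have hcl := hM.classification hR
  obtain ⟨h1, h2, h3, h4, h5, h6, h7, h8, h9, h10⟩ := hR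
  have hrot := isAntiIso_shape h1.le h2.le h6 h7
  rcases hcl with hc | ⟨rfl, rfl, rfl⟩ | ⟨rfl, rfl, rfl⟩ | ⟨rfl, rfl, rfl, rfl⟩ |
    ⟨rfl, rfl, rfl, rfl⟩ | ⟨rfl, rfl, rfl, rfl⟩ | ⟨rfl, rfl, rfl, rfl⟩ | ⟨rfl, rfl, rfl, rfl⟩ |
    ⟨rfl, rfl, rfl, rfl⟩ | ⟨rfl, rfl, rfl, hw, hw'⟩ | ⟨rfl, rfl, rfl, hh, hh'⟩
  · have e : shape h w S u P v = shape h w 0 0 1 1 := shape_congr fun i j _ _ => by omega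
    rw [e]
    exact ⟨_, .hook (by omega) (by omega), rfl, rfl⟩
  · obtain rfl : u = 0 := by omega
    exact ⟨_, .hook (by omega) (by omega), rfl, rfl⟩
  · obtain rfl : v = u + 1 := by omega
    rw [Nat.sub_self, Nat.sub_self, Nat.add_sub_cancel_left, Nat.add_sub_cancel_left] at hrot
    exact ⟨_, .hook (by omega) (by omega),
      hrot.words_eq_of_reverse_mem (reverse_mem_words_hook (by omega) (by omega)), hrot.card_eq⟩
  · exact ⟨_, .pair (by omega) (by omega), rfl, rfl⟩
  · rw [Nat.add_sub_cancel_left, Nat.add_sub_cancel_left] at hrot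
    exact ⟨_, .pair (by omega) (by omega),
      hrot.words_eq_of_reverse_mem (reverse_mem_words_pair (by omega) (by omega)), hrot.card_eq⟩
  · obtain rfl : u = 0 := by omega
    exact ⟨_, .two_row (by omega), rfl, rfl⟩
  · obtain rfl : v = u + 2 := by omega
    rw [Nat.sub_self, Nat.sub_self, Nat.add_sub_cancel_left] at hrot
    exact ⟨_, .two_row (by omega),
      hrot.words_eq_of_reverse_mem (reverse_mem_words_two_row (by omega)), hrot.card_eq⟩
  · obtain rfl : u = 0 := by omega
    exact ⟨_, .two_column (by omega), rfl, rfl⟩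
  · obtain rfl : v = 2 := by omega
    rw [Nat.sub_self, Nat.sub_self, Nat.add_sub_cancel_left] at hrot
    exact ⟨_, .two_column (by omega),
      hrot.words_eq_of_reverse_mem (reverse_mem_words_two_column (by omega)), hrot.card_eq⟩
  · obtain rfl : u = 0 := by omega
    obtain rfl : v = w := by omega
    obtain rfl | rfl | rfl : v = 2 ∨ v = 3 ∨ v = 4 := by omega
    · rw [show shape 2 2 0 0 2 2 = shape 2 2 0 0 1 2 by decide]
      exact ⟨_, .two_row le_rfl, rfl, rfl⟩
    · exact ⟨_, .rect_two_three, rfl, rfl⟩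
    · exact ⟨_, .rect_two_four, rfl, rfl⟩
  · obtain rfl : u = 0 := by omega
    obtain rfl : v = 2 := by omega
    obtain rfl | rfl | rfl : P = 2 ∨ P = 3 ∨ P = 4 := by omega
    · rw [show shape 2 2 0 0 2 2 = shape 2 2 0 0 1 2 by decide]
      exact ⟨_, .two_row le_rfl, rfl, rfl⟩
    · exact ⟨_, .rect_three_two, rfl, rfl⟩
    · exact ⟨_, .rect_four_two, rfl, rfl⟩

theorem MultFree.exists_canonical (hM : MultFree C) (hC : Convex C) (hne : C.Nonempty) :
    ∃ D, Canonical D ∧ words C = words D ∧ C.card = D.card := by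
  obtain ⟨D, φ, h, w, hφ, hD, hb, hrow, hcol⟩ := exists_isIso_normalized hC
  have hDne : D.Nonempty := by
    rw [← Finset.card_pos, hφ.card_eq, Finset.card_pos]
    exact hne
  obtain ⟨S, u, P, v, hR, rfl⟩ := (hφ.multFree hM).eq_shape hD hDne hb hrow hcol
  obtain ⟨D', h1, h2, h3⟩ := (hφ.multFree hM).exists_canonical_of_shape hR
  exact ⟨D', h1, hφ.words_eq.symm.trans h2, hφ.card_eq.symm.trans h3⟩

theorem Canonical.convex (hD : Canonical D) : Convex D := by
  cases hD <;> exact convex_shape _ _ _ _ _ _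

theorem MultFree.words_subset_iff {A B : Finset (ℕ × ℕ)} (hA : MultFree A) (hB : MultFree B)
    (cA : Convex A) (cB : Convex B) (hcard : A.card = B.card) :
    words B ⊆ words A ↔
      ∀ k l, rects (k + 1) (l + 1) A ≤ rects (k + 1) (l + 1) B := by
  refine ⟨fun h => rects_le_of_words_subset cA cB hcard h, fun h => ?_⟩
  rcases A.eq_empty_or_nonempty with rfl | neA
  · rw [Finset.card_empty, eq_comm, Finset.card_eq_zero] at hcard
    rw [hcard]
  have neB : B.Nonempty := by
    rw [← Finset.card_pos, ← hcard, Finset.card_pos]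
    exact neA
  obtain ⟨A', a1, a2, a3⟩ := hA.exists_canonical cA neA
  obtain ⟨B', b1, b2, b3⟩ := hB.exists_canonical cB neB
  rw [a2, b2]
  -- Equal word sets force equal rectangle counts, by the general direction applied both ways, so
  -- the hypothesis passes to the representatives.
  refine a1.words_subset b1 (by rw [← a3, hcard, b3]) fun k l => ?_
  rw [← rects_eq_of_words_eq cA a1.convex a3 a2, ← rects_eq_of_words_eq cB b1.convex b3 b2]
  exact h k l

end CellSet

theorem corollary6p4 (A B : SkewShape) (hsize : A.size = B.size)
    (hA : A.FMultiplicityFree) (hB : B.FMultiplicityFree) :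
    B.fSupport ⊆ A.fSupport ↔
      ∀ k, 1 ≤ k → DominanceLE (A.rowsOverlap k) (B.rowsOverlap k) := by
  rw [SkewShape.fSupport_subset_iff hsize, SkewShape.forall_dominanceLE_rowsOverlap_iff]
  exact hA.multFree.words_subset_iff hB.multFree A.convex_cells B.convex_cells hsize
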